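/- **Conventions.** A *graph* $\Gamma=(V\Gamma,A\Gamma,o,r)$ consists of a set of vertices, a set of arcs, an origin map $o:A\Gamma\to V\Gamma$ and a map $r:A\Gamma\to A\Gamma$, $a\mapsto\overline a$, with $r^2=\mathrm{id}$; put $t(a)=o(\overline a)$. (An arc may equal its own reverse.) Connected graphs and trees are non-empty; a tree $T$ is a connected simple graph without cycles, its arcs being the ordered pairs of adjacent vertices. For a set $X$, $\mathrm{Sym}(X)$ carries the permutation topology (pointwise convergence, $X$ discrete), and $\mathrm{Aut}(T)\le\mathrm{Sym}(VT)$ the subspace topology. A *local action diagram* $\Delta=(\Gamma,(X_a),(G(v)))$ consists of a connected graph $\Gamma$, a non-empty set $X_a$ for each $a\in A\Gamma$, and for each $v\in V\Gamma$ a closed subgroup $G(v)$ of $\mathrm{Sym}(X_v)$, where $X_v=\bigsqcup_{a\in o^{-1}(v)}X_a$, whose orbits on $X_v$ are exactly the sets $X_a$, $a\in o^{-1}(v)$. An *isomorphism* $\Delta\to\Delta'$ is a graph isomorphism $\theta:\Gamma\to\Gamma'$ together with bijections $\theta_v:X_v\to X'_{\theta(v)}$ with $\theta_v(X_a)=X'_{\theta(a)}$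 for $a\in o^{-1}(v)$ and $\theta_vG(v)\theta_v^{-1}=G'(\theta(v))$. A *$\Delta$-tree* is a tree $T$ with a surjective graph homomorphism $\pi:T\to\Gamma$ and a map $\mathcal L:AT\to\bigsqcup_{a\in A\Gamma}X_a$ that restricts, for all $v\in VT$ and $a\in o^{-1}(\pi(v))$, to a bijection from $\{b\in o^{-1}(v):\pi(b)=a\}$ onto $X_a$. For $g\in\mathrm{Aut}(T)$ with $\pi g=\pi$ and $v\in VT$ let $\sigma_{\mathcal L,v}(g)\in\mathrm{Sym}(X_{\pi(v)})$ be the permutation $\mathcal L(b)\mapsto\mathcal L(gb)$, $b\in o^{-1}(v)$. The *universal group* of the $\Delta$-tree $\mathbf T=(T,\pi,\mathcal L)$ is $$U_{\mathbf T}(\Delta)=\{g\in\mathrm{Aut}(T):\ \pi g=\pi\ \text{and}\ \sigma_{\mathcal L,v}(g)\in G(\pi(v))\ \text{for all } v\in VT\}.$$ A subgroup $G\le\mathrm{Aut}(T)$ is *P-closed* (has Tits' property P) if it is closed and, for every non-empty (finite, one-way infinite or two-way infinite) simple path $L$ in $T$ with closest point projection $\pi_L:VT\to VL$ and pointwise stabilizer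 $G_{(L)}$, the natural map $G_{(L)}\to\prod_{x\in VL}\phi_x(G_{(L)})$ is onto, where $\phi_x(G_{(L)})$ is the permutation group induced by $G_{(L)}$ on $\pi_L^{-1}(x)$. For arbitrary $G\le \mathrm{Aut}(T)$, $G^{P_1}$ denotes the group of all $g\in\mathrm{Aut}(T)$ such that for each $v\in VT$ and each finite set $X$ of vertices at distance at most $1$ from $v$ some element of $G$ agrees with $g$ on $X$. Pairs $(T,G)$ and $(T',G')$ are *conjugate* if $\theta G\theta^{-1}=G'$ for some graph isomorphism $\theta:T\to T'$. Given a tree $T$ and $G\le\mathrm{Aut}(T)$, an *associated local action diagram* $\Delta(T,G)$ is obtained as follows: $\Gamma=G\backslash T$ is the quotient graph, with quotient map $\pi$; choose $v^*\in\pi^{-1}(v)$ for each $v\in V\Gamma$; put $X_a=\{b\in o^{-1}(v^*):\pi(b)=a\}$ for $a\in A\Gamma$, $v=o(a)$, so that $X_v=o^{-1}(v^*)$; and let $G(v)$ be the closure in $\mathrm{Sym}(X_v)$ of the permutation group induced by the stabilizer $G_{v^*}$. Choosing $g_w\in G$ with $g_ww=\pi(w)^*$ for each $w\in VT$ and setting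 $\mathcal L(b)=g_{o(b)}b$ makes $T$ a $\Delta(T,G)$-tree, called an associated $\Delta(T,G)$-tree. **Theorem.** 1. Every local action diagram $\Delta$ has a $\Delta$-tree, and for every $\Delta$-tree $\mathbf T=(T,\pi,\mathcal L)$ the group $U_{\mathbf T}(\Delta)$ is a P-closed subgroup of $\mathrm{Aut}(T)$. 2. There is a bijection from the isomorphism classes of local action diagrams to the conjugacy classes of pairs $(T,G)$, where $T$ is a tree and $G$ is a P-closed subgroup of $\mathrm{Aut}(T)$, that takes the class of $\Delta$ to the class of $(T,U_{\mathbf T}(\Delta))$ for every $\Delta$-tree $\mathbf T=(T,\pi,\mathcal L)$, and whose inverse takes the class of $(T,G)$ to the class of $\Delta(T,G)$, for any choices made in its construction. 3. For every tree $T$, every subgroup $G\le\mathrm{Aut}(T)$ and every choice of the associated diagram $\Delta(T,G)$ and the associated $\Delta(T,G)$-tree $\mathbf T$ on $T$, the group $U_{\mathbf T}(\Delta(T,G))$ is the P-closure of $G$: it is the smallest P-closed subgroup of $\mathrm{Aut}(T)$ containing $G$, and it equals $G^{P_1}$. -/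

import Mathlib

universe u

namespace LocalActionTree

/-! ### Graphs -/

/-- A graph in the sense of Serre, except that a loop may be equal to its own reverse:
vertices, arcs, the origin map, and an arc reversal that is an involution
(possibly with fixed points). -/
structure SerreGraph where
  /-- vertices -/
  V : Type u
  /-- arcs -/
  A : Type u
  /-- origin of an arc -/
  o : A → V
  /-- reversal of arcs -/
  r : A → A
  r_r : ∀ a, r (r a) = a

namespace SerreGraph

/-- The terminal vertex of an arc. -/
def t (Γ : SerreGraph.{u}) (a : Γ.A) : Γ.V := Γ.o (Γ.r a)

/-- A graph is connected if it has a vertex and any two vertices are joined by a finite path. -/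
def Connected (Γ : SerreGraph.{u}) : Prop :=
  Nonempty Γ.V ∧
    ∀ v w : Γ.V, Relation.ReflTransGen (fun x y => ∃ a : Γ.A, Γ.o a = x ∧ Γ.t a = y) v w

/-- Given a family of sets `X a` indexed by the arcs, `Γ.ColoursAt X v` is the disjoint union
of the `X a` over all arcs `a` with origin `v`, as a subset of the disjoint union of all `X a`. -/
abbrev ColoursAt (Γ : SerreGraph.{u}) (X : Γ.A → Type u) (v : Γ.V) : Type u :=
  {c : Σ a : Γ.A, X a // Γ.o c.1 = v}

end SerreGraph

/-! ### Topologies -/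

/-- The permutation topology on `Sym(X)`: the topology of pointwise convergence for the discrete
topology on `X`. -/
@[reducible] def permTopology (X : Type*) : TopologicalSpace (Equiv.Perm X) :=
  TopologicalSpace.induced (fun (σ : Equiv.Perm X) (x : X) => σ x)
    (@Pi.topologicalSpace X (fun _ => X) (fun _ => ⊥))

/-- The topology on the automorphism group of a tree, as a subspace of `Sym(VT)`. -/
@[reducible] def autTopology {V : Type*} (T : SimpleGraph V) : TopologicalSpace (T ≃g T) :=
  TopologicalSpace.induced (fun g : T ≃g T => (g.toEquiv : Equiv.Perm V)) (permTopology V)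

theorem mem_permClosure_iff {X : Type*} (S : Set (Equiv.Perm X)) (σ : Equiv.Perm X) :
    σ ∈ @closure _ (permTopology X) S ↔
      ∀ F : Finset X, ∃ τ ∈ S, ∀ x ∈ F, τ x = σ x := by
  let _ : TopologicalSpace X := ⊥
  have _ : DiscreteTopology X := ⟨rfl⟩
  let _ : TopologicalSpace (Equiv.Perm X) := permTopology X
  have hind : Topology.IsInducing (fun (σ : Equiv.Perm X) (x : X) => σ x) := ⟨rfl⟩
  rw [hind.closure_eq_preimage_closure_image, Set.mem_preimage, mem_closure_iff]
  constructor
  · intro h F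
    obtain ⟨f, hf, ⟨τ, hτ, rfl⟩⟩ := h (Set.pi (F : Set X) fun x => {σ x})
      (isOpen_set_pi F.finite_toSet fun _ _ => isOpen_discrete _) (fun x _ => rfl)
    exact ⟨τ, hτ, fun x hx => hf x hx⟩
  · intro h U hU hσ
    obtain ⟨F, u, hu, hsub⟩ := isOpen_pi_iff.1 hU _ hσ
    obtain ⟨τ, hτ, hF⟩ := h F
    refine ⟨fun x => τ x, hsub fun x hx => ?_, ⟨τ, hτ, rfl⟩⟩
    have := hF x hx
    simp only [this]
    exact (hu x hx).2

/-- The closure of a permutation group in `Sym(X)`, again a permutation group. -/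
def permClosure {X : Type*} (H : Subgroup (Equiv.Perm X)) : Subgroup (Equiv.Perm X) where
  carrier := @closure _ (permTopology X) (H : Set (Equiv.Perm X))
  mul_mem' := by
    classical
    intro a b ha hb
    rw [mem_permClosure_iff] at *
    intro F
    obtain ⟨τ, hτ, hF⟩ := hb F
    obtain ⟨ρ, hρ, hF'⟩ := ha (F.image b)
    refine ⟨ρ * τ, H.mul_mem hρ hτ, fun x hx => ?_⟩
    rw [Equiv.Perm.mul_apply, Equiv.Perm.mul_apply, hF x hx,
      hF' _ (Finset.mem_image_of_mem _ hx)]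
  one_mem' := (mem_permClosure_iff _ _).2 fun _ => ⟨1, H.one_mem, fun _ _ => rfl⟩
  inv_mem' := by
    classical
    intro a ha
    change a ∈ @closure _ (permTopology X) (H : Set (Equiv.Perm X)) at ha
    change a⁻¹ ∈ @closure _ (permTopology X) (H : Set (Equiv.Perm X))
    rw [mem_permClosure_iff] at *
    intro F
    obtain ⟨τ, hτ, hF⟩ := ha (F.image ⇑a⁻¹)
    refine ⟨τ⁻¹, H.inv_mem hτ, fun x hx => ?_⟩
    have := hF _ (Finset.mem_image_of_mem _ hx)
    rw [Equiv.Perm.inv_eq_iff_eq, this, Equiv.Perm.coe_inv, Equiv.apply_symm_apply]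

/-! ### Local action diagrams -/

/-- A local action diagram. The local action `G v` acts on the disjoint union of the colour sets
of the arcs with origin `v`; it is closed in the permutation topology and its orbits are exactly
these colour sets. -/
structure LocalActionDiagram where
  Γ : SerreGraph.{u}
  connected : Γ.Connected
  /-- the colour set of an arc -/
  X : Γ.A → Type u
  nonempty_X : ∀ a, Nonempty (X a)
  /-- the local action at a vertex -/
  G : ∀ v : Γ.V, Subgroup (Equiv.Perm (Γ.ColoursAt X v))
  closed_G : ∀ v, @IsClosed _ (permTopology (Γ.ColoursAt X v))
    (G v : Set (Equiv.Perm (Γ.ColoursAt X v)))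
  orbits_G : ∀ v (c d : Γ.ColoursAt X v), (∃ σ ∈ G v, σ c = d) ↔ c.1.1 = d.1.1

namespace LocalActionDiagram

/-- The set `X_v` on which the local action at `v` acts. -/
abbrev Colours (Δ : LocalActionDiagram.{u}) (v : Δ.Γ.V) : Type u := Δ.Γ.ColoursAt Δ.X v

/-- An isomorphism of local action diagrams: an isomorphism of graphs together with bijections
`X_v → X'_{θ v}` mapping `X_a` to `X'_{θ a}` and conjugating `G(v)` to `G'(θ v)`. -/
structure Iso (Δ Δ' : LocalActionDiagram.{u}) where
  onV : Δ.Γ.V ≃ Δ'.Γ.V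
  onA : Δ.Γ.A ≃ Δ'.Γ.A
  map_o : ∀ a, Δ'.Γ.o (onA a) = onV (Δ.Γ.o a)
  map_r : ∀ a, Δ'.Γ.r (onA a) = onA (Δ.Γ.r a)
  onX : ∀ v, Δ.Colours v ≃ Δ'.Colours (onV v)
  map_X : ∀ v (c : Δ.Colours v), (onX v c).1.1 = onA c.1.1
  map_G : ∀ v (σ : Equiv.Perm (Δ.Colours v)),
    σ ∈ Δ.G v ↔ ((onX v).symm.trans σ).trans (onX v) ∈ Δ'.G (onV v)

theorem Iso.exists_symm {Δ Δ' : LocalActionDiagram.{u}} (θ : Iso Δ Δ') (v' : Δ'.Γ.V) :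
    ∃ f : Δ'.Colours v' ≃ Δ.Colours (θ.onV.symm v'),
      (∀ c, (f c).1.1 = θ.onA.symm c.1.1) ∧
      ∀ σ : Equiv.Perm (Δ'.Colours v'),
        σ ∈ Δ'.G v' ↔ (f.symm.trans σ).trans f ∈ Δ.G (θ.onV.symm v') := by
  obtain ⟨v, rfl⟩ := θ.onV.surjective v'
  have h : θ.onV.symm (θ.onV v) = v := θ.onV.symm_apply_apply v
  generalize θ.onV.symm (θ.onV v) = w at h
  subst h
  refine ⟨(θ.onX w).symm, fun c => ?_, fun σ => ?_⟩
  · rw [Equiv.eq_symm_apply, ← θ.map_X, Equiv.apply_symm_apply]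
  · rw [θ.map_G]
    have : ((θ.onX w).symm.trans
        (((θ.onX w).symm.symm.trans σ).trans (θ.onX w).symm)).trans (θ.onX w) = σ := by
      ext1 c; simp
    rw [this]

/-- Isomorphism as an equivalence relation on local action diagrams. -/
instance isoSetoid : Setoid LocalActionDiagram.{u} where
  r Δ Δ' := Nonempty (Iso Δ Δ')
  iseqv :=
    { refl := fun Δ => ⟨
        { onV := Equiv.refl _, onA := Equiv.refl _, map_o := fun _ => rfl, map_r := fun _ => rfl
          onX := fun _ => Equiv.refl _, map_X := fun _ _ => rfl, map_G := fun _ _ => Iff.rfl }⟩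
      symm := by
        rintro Δ Δ' ⟨θ⟩
        choose f hf hG using θ.exists_symm
        exact ⟨
          { onV := θ.onV.symm
            onA := θ.onA.symm
            map_o := fun a => by
              rw [Equiv.eq_symm_apply, ← θ.map_o, Equiv.apply_symm_apply]
            map_r := fun a => by
              rw [Equiv.eq_symm_apply, ← θ.map_r, Equiv.apply_symm_apply]
            onX := f
            map_X := hf
            map_G := hG }⟩
      trans := by
        rintro Δ Δ' Δ'' ⟨θ⟩ ⟨η⟩
        exact ⟨
          { onV := θ.onV.trans η.onV
            onA := θ.onA.trans η.onA
            map_o := fun a => by simp [η.map_o, θ.map_o]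
            map_r := fun a => by simp [η.map_r, θ.map_r]
            onX := fun v => (θ.onX v).trans (η.onX (θ.onV v))
            map_X := fun v c => 
              (η.map_X _ (θ.onX v c)).trans (congrArg η.onA (θ.map_X v c))
            map_G := fun v σ => by
              rw [θ.map_G, η.map_G]
              rfl }⟩ }

end LocalActionDiagram

/-! ### Automorphisms of trees

Trees are Mathlib's `SimpleGraph`s that satisfy `IsTree`. The arcs of a tree `T` are its darts
(ordered pairs of adjacent vertices), the origin of a dart `b` is `b.fst`, its reverse is
`b.symm`, and automorphisms are the permutations of the vertices that respect adjacency. -/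

section Aut

variable {V : Type u} {T : SimpleGraph V}

/-- The action of the automorphism group on arcs. -/
instance dartAction : MulAction (T ≃g T) T.Dart where
  smul g b := ⟨(g b.fst, g b.snd), g.map_rel_iff.2 b.adj⟩
  one_smul _ := rfl
  mul_smul _ _ _ := rfl

theorem smul_fst (g : T ≃g T) (b : T.Dart) : (g • b).fst = g b.fst := rfl

theorem smul_snd (g : T ≃g T) (b : T.Dart) : (g • b).snd = g b.snd := rfl

theorem smul_symm (g : T ≃g T) (b : T.Dart) : (g • b).symm = g • b.symm := rfl

/-- `g` as a bijection from the arcs originating at `v` to the arcs originating at `g v`. -/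
def dartsAt (g : T ≃g T) (v : V) : {b : T.Dart // b.fst = v} ≃ {b : T.Dart // b.fst = g v} where
  toFun b := ⟨g • b.1, by rw [smul_fst, b.2]⟩
  invFun b := ⟨g⁻¹ • b.1, by rw [smul_fst, b.2, RelIso.inv_apply_self]⟩
  left_inv b := Subtype.ext (inv_smul_smul g b.1)
  right_inv b := Subtype.ext (smul_inv_smul g b.1)

variable (T)

theorem dist_map_le (g : T ≃g T) (hT : T.Connected) (v w : V) :
    T.dist (g v) (g w) ≤ T.dist v w := by
  obtain ⟨p, hp⟩ := hT.exists_walk_length_eq_dist v w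
  rw [← hp, ← SimpleGraph.Walk.length_map g.toHom p]
  exact SimpleGraph.dist_le (p.map g.toHom)

theorem dist_map (g : T ≃g T) (hT : T.Connected) (v w : V) :
    T.dist (g v) (g w) = T.dist v w := by
  refine le_antisymm (dist_map_le T g hT v w) ?_
  simpa using dist_map_le T g⁻¹ hT (g v) (g w)

/-- The `P_k`-closure of a group `G` of automorphisms of a tree: the automorphisms that agree
with some element of `G` on any given finite set of vertices contained in a ball of radius `k`. -/
def pkClosure (hT : T.IsTree) (k : ℕ) (G : Subgroup (T ≃g T)) : Subgroup (T ≃g T) where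
  carrier := {g | ∀ (v : V) (F : Finset V), (∀ w ∈ F, T.dist v w ≤ k) →
    ∃ h ∈ G, ∀ w ∈ F, g w = h w}
  mul_mem' := by
    classical
    intro a b ha hb v F hF
    obtain ⟨h, hh, hF1⟩ := hb v F hF
    obtain ⟨h', hh', hF2⟩ := ha (b v) (F.image b) (by
      intro w hw
      obtain ⟨x, hx, rfl⟩ := Finset.mem_image.1 hw
      rw [dist_map T b hT.connected]
      exact hF x hx)
    refine ⟨h' * h, G.mul_mem hh' hh, fun w hw => ?_⟩
    rw [RelIso.mul_apply, RelIso.mul_apply, ← hF1 w hw,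
      hF2 _ (Finset.mem_image_of_mem _ hw)]
  one_mem' := fun _ _ _ => ⟨1, G.one_mem, fun _ _ => rfl⟩
  inv_mem' := by
    classical
    intro a ha v F hF
    obtain ⟨h, hh, hF1⟩ := ha (a⁻¹ v) (F.image ⇑a⁻¹) (by
      intro w hw
      obtain ⟨x, hx, rfl⟩ := Finset.mem_image.1 hw
      rw [dist_map T a⁻¹ hT.connected]
      exact hF x hx)
    refine ⟨h⁻¹, G.inv_mem hh, fun w hw => ?_⟩
    have := hF1 _ (Finset.mem_image_of_mem _ hw)
    rw [RelIso.apply_inv_self] at this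
    apply h.injective
    rw [← this, RelIso.apply_inv_self]

/-- `L` is the vertex set of a non-empty simple path in `T`, which may be finite, infinite in one
direction or infinite in both directions: the vertices of the path are indexed by a non-empty
interval `I` of integers. -/
def IsPathSet (L : Set V) : Prop :=
  ∃ (I : Set ℤ) (p : ℤ → V), I.Nonempty ∧ I.OrdConnected ∧ Set.InjOn p I ∧
    (∀ i, i ∈ I → i + 1 ∈ I → T.Adj (p i) (p (i + 1))) ∧ L = p '' I

/-- The fibre over `x ∈ L` of the closest point projection of a tree onto the path `L`. -/
def projFibre (L : Set V) (x : V) : Set V :=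
  {w | ∀ y ∈ L, T.dist w x ≤ T.dist w y}

/-- Tits' property P: the group `G` is closed in the automorphism group of `T`, and for every
non-empty path `L`, if `s x` (`x ∈ L`) is a family of elements of the pointwise stabilizer
`G_(L)`, then there is an element of `G_(L)` that acts on each fibre of the closest point
projection onto `L`, say the fibre over `x`, as `s x` does. In other words, the natural map from
`G_(L)` to the product over `x ∈ L` of the groups induced by `G_(L)` on these fibres is onto. -/
def HasPropertyP (G : Subgroup (T ≃g T)) : Prop :=
  @IsClosed _ (autTopology T) (G : Set (T ≃g T)) ∧
  ∀ L : Set V, IsPathSet T L → ∀ s : L → (T ≃g T),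
    (∀ x, s x ∈ G ∧ ∀ y ∈ L, s x y = y) →
    ∃ g ∈ G, (∀ y ∈ L, g y = y) ∧ ∀ x : L, ∀ w ∈ projFibre T L x, g w = s x w

end Aut

/-- A `P`-closed action on a tree: a pair `(T, G)` of a tree and a subgroup of its automorphism
group with property P. -/
structure PClosedAction where
  V : Type u
  T : SimpleGraph V
  isTree : T.IsTree
  G : Subgroup (T ≃g T)
  propertyP : HasPropertyP T G

/-- Conjugacy of actions: `(T, G)` and `(T', G')` are conjugate if there is a graph isomorphism
`θ : T → T'` with `θ G θ⁻¹ = G'`. -/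
instance PClosedAction.conjSetoid : Setoid PClosedAction.{u} where
  r P Q := ∃ θ : P.T ≃g Q.T, ∀ g : P.T ≃g P.T, g ∈ P.G ↔ (θ.symm.trans g).trans θ ∈ Q.G
  iseqv :=
    { refl := fun P => ⟨RelIso.refl _, fun g => Iff.rfl⟩
      symm := by
        rintro P Q ⟨θ, h⟩
        refine ⟨θ.symm, fun g => ?_⟩
        rw [h]
        have : (θ.symm.trans ((θ.symm.symm.trans g).trans θ.symm)).trans θ = g := by
          ext1 c; simp
        rw [this]
      trans := by
        rintro P Q R ⟨θ, h⟩ ⟨η, k⟩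
        refine ⟨θ.trans η, fun g => ?_⟩
        rw [h, k]
        rfl }

/-! ### Trees over a local action diagram and the universal group -/

/-- The structure of a `Δ`-tree on `T`: the graph `T` is a tree, equipped with a surjective graph
homomorphism `(πV, πA)` onto the graph of `Δ` and a colouring `L` of its arcs that restricts, for
every vertex `v` of `T` and every arc `a` originating at `πV v`, to a bijection from the set of
arcs over `a` originating at `v` to the colour set `X a`. -/
structure DeltaTree (Δ : LocalActionDiagram.{u}) {V : Type u} (T : SimpleGraph V) where
  isTree : T.IsTree
  πV : V → Δ.Γ.V
  πA : T.Dart → Δ.Γ.A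
  map_o : ∀ b : T.Dart, Δ.Γ.o (πA b) = πV b.fst
  map_r : ∀ b : T.Dart, Δ.Γ.r (πA b) = πA b.symm
  πV_surjective : Function.Surjective πV
  πA_surjective : Function.Surjective πA
  L : T.Dart → Σ a : Δ.Γ.A, Δ.X a
  L_bijOn : ∀ v a, Δ.Γ.o a = πV v →
    Set.BijOn L {b : T.Dart | b.fst = v ∧ πA b = a} {c : Σ a : Δ.Γ.A, Δ.X a | c.1 = a}

namespace DeltaTree

variable {Δ : LocalActionDiagram.{u}} {V : Type u} {T : SimpleGraph V} (S : DeltaTree Δ T)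

theorem L_fst (b : T.Dart) : (S.L b).1 = S.πA b :=
  (S.L_bijOn b.fst (S.πA b) (S.map_o b)).mapsTo ⟨rfl, rfl⟩

/-- The restriction of the colouring to a bijection from the arcs of `T` originating at `v`
to `X_{π v}`. -/
noncomputable def colourAt (v : V) : {b : T.Dart // b.fst = v} ≃ Δ.Colours (S.πV v) :=
  Equiv.ofBijective (fun b => ⟨S.L b.1, by rw [S.L_fst, S.map_o, b.2]⟩) (by
    constructor
    · rintro ⟨b, rfl⟩ ⟨b', hb'⟩ h
      have hL : S.L b = S.L b' := congrArg Subtype.val h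
      refine Subtype.ext ((S.L_bijOn b.fst (S.πA b) (S.map_o b)).injOn ⟨rfl, rfl⟩ ⟨hb', ?_⟩ hL)
      rw [← S.L_fst, ← S.L_fst, hL]
    · rintro ⟨c, hc⟩
      obtain ⟨b, ⟨hb, -⟩, hbc⟩ := (S.L_bijOn v c.1 hc).surjOn rfl
      exact ⟨⟨b, hb⟩, Subtype.ext hbc⟩)

theorem colourAt_coe (v : V) (b : {b : T.Dart // b.fst = v}) :
    (S.colourAt v b).1 = S.L b.1 := rfl

/-- The group of automorphisms of a `Δ`-tree, that is, of all automorphisms `g` of the tree with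
`π ∘ g = π`. -/
def autπ : Subgroup (T ≃g T) where
  carrier := {g | (∀ v, S.πV (g v) = S.πV v) ∧ ∀ b : T.Dart, S.πA (g • b) = S.πA b}
  mul_mem' := by
    rintro a b ⟨ha, ha'⟩ ⟨hb, hb'⟩
    refine ⟨fun v => ?_, fun d => ?_⟩
    · rw [RelIso.mul_apply, ha, hb]
    · rw [mul_smul, ha', hb']
  one_mem' := ⟨fun _ => rfl, fun _ => rfl⟩
  inv_mem' := by
    rintro a ⟨ha, ha'⟩
    refine ⟨fun v => ?_, fun d => ?_⟩
    · rw [← ha (a⁻¹ v), RelIso.apply_inv_self]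
    · rw [← ha' (a⁻¹ • d), smul_inv_smul]

/-- The local action of `g` at `v`: the permutation of `X_{π v}` that takes the colour of an arc
`b` originating at `v` to the colour of `g b` (note that `X_{π (g v)} = X_{π v}`). -/
noncomputable def localAction (g : S.autπ) (v : V) : Equiv.Perm (Δ.Colours (S.πV v)) :=
  (((S.colourAt v).symm.trans (dartsAt g.1 v)).trans (S.colourAt (g.1 v))).trans
    (Equiv.subtypeEquivRight fun c => by rw [g.2.1 v])

theorem localAction_colourAt (g : S.autπ) (v : V) (b : {b : T.Dart // b.fst = v}) :
    (S.localAction g v (S.colourAt v b)).1 = S.L (g.1 • b.1) := by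
  simp [localAction, dartsAt, colourAt_coe]

theorem mem_G_iff {v : V} (σ : Equiv.Perm (Δ.Colours (S.πV v))) (w : V) (h : S.πV w = S.πV v)
    (τ : Equiv.Perm (Δ.Colours (S.πV w)))
    (hστ : ∀ c hc hc', (σ ⟨c, hc⟩).1 = (τ ⟨c, hc'⟩).1) : σ ∈ Δ.G _ ↔ τ ∈ Δ.G _ := by
  generalize S.πV w = x at *
  subst h
  have : σ = τ := Equiv.ext fun c => Subtype.ext (hστ c.1 c.2 c.2)
  rw [this]

/-- The universal group of a `Δ`-tree: the automorphisms `g` of the `Δ`-tree all of whose local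
actions belong to the prescribed groups `G(π v)`. -/
def universalGroup : Subgroup (T ≃g T) where
  carrier := {g | ∃ hg : g ∈ S.autπ, ∀ v, S.localAction ⟨g, hg⟩ v ∈ Δ.G (S.πV v)}
  mul_mem' := by
    rintro a b ⟨ha, ha'⟩ ⟨hb, hb'⟩
    refine ⟨S.autπ.mul_mem ha hb, fun v => ?_⟩
    have key : S.localAction ⟨a * b, S.autπ.mul_mem ha hb⟩ v * (S.localAction ⟨b, hb⟩ v)⁻¹
        ∈ Δ.G (S.πV v) := by
      refine (S.mem_G_iff _ (b v) (hb.1 v) (S.localAction ⟨a, ha⟩ (b v)) ?_).2 (ha' (b v))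
      intro c hc hc'
      obtain ⟨e, he⟩ := (S.localAction ⟨b, hb⟩ v).surjective ⟨c, hc⟩
      obtain ⟨d, rfl⟩ := (S.colourAt v).surjective e
      have hc1 : c = S.L (b • d.1) := by
        rw [← S.localAction_colourAt ⟨b, hb⟩ v d, he]
      have hd : (⟨c, hc'⟩ : Δ.Colours (S.πV (b v))) = S.colourAt (b v) (dartsAt b v d) :=
        Subtype.ext hc1
      rw [← he, Equiv.Perm.mul_apply, Equiv.Perm.coe_inv, Equiv.symm_apply_apply, hd, S.localAction_colourAt,
        S.localAction_colourAt]
      simp only [dartsAt, Equiv.coe_fn_mk, mul_smul]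
    simpa using (Δ.G _).mul_mem key (hb' v)
  one_mem' := by
    refine ⟨S.autπ.one_mem, fun v => ?_⟩
    have : S.localAction ⟨1, S.autπ.one_mem⟩ v = 1 := by
      refine Equiv.ext fun c => ?_
      obtain ⟨d, rfl⟩ := (S.colourAt v).surjective c
      apply Subtype.ext
      rw [S.localAction_colourAt, one_smul]
      rfl
    rw [this]
    exact (Δ.G _).one_mem
  inv_mem' := by
    rintro a ⟨ha, ha'⟩
    refine ⟨S.autπ.inv_mem ha, fun v => ?_⟩
    rw [← inv_mem_iff]
    have hv : S.πV (a⁻¹ v) = S.πV v := (S.autπ.inv_mem ha).1 v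
    refine (S.mem_G_iff _ (a⁻¹ v) hv (S.localAction ⟨a, ha⟩ (a⁻¹ v)) ?_).2 (ha' (a⁻¹ v))
    intro c hc hc'
    obtain ⟨d, hd⟩ := (S.colourAt (a⁻¹ v)).surjective ⟨c, hc'⟩
    have hcd : c = S.L d.1 := by rw [← S.colourAt_coe, hd]
    rw [← hd, S.localAction_colourAt]
    have hfst : (a • d.1).fst = v := by rw [smul_fst, d.2, RelIso.apply_inv_self]
    have : (⟨c, hc⟩ : Δ.Colours (S.πV v)) =
        S.localAction ⟨a⁻¹, S.autπ.inv_mem ha⟩ v (S.colourAt v ⟨a • d.1, hfst⟩) := by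
      apply Subtype.ext
      rw [S.localAction_colourAt, inv_smul_smul]
      exact hcd
    rw [this, Equiv.Perm.coe_inv, Equiv.symm_apply_apply]
    rfl

end DeltaTree

/-! ### The local action diagram of a group acting on a tree -/

section Associated

variable {V : Type u} (T : SimpleGraph V) (G : Subgroup (T ≃g T))

/-- The quotient graph `G \ T`: its vertices and arcs are the `G`-orbits on vertices and arcs. -/
def quotientGraph : SerreGraph.{u} where
  V := MulAction.orbitRel.Quotient G V
  A := MulAction.orbitRel.Quotient G T.Dart
  o := Quotient.map' (fun b : T.Dart => b.fst) (by
    rintro _ b ⟨g, rfl⟩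
    exact ⟨g, rfl⟩)
  r := Quotient.map' (fun b : T.Dart => b.symm) (by
    rintro _ b ⟨g, rfl⟩
    exact ⟨g, rfl⟩)
  r_r := by
    intro a
    induction a using Quotient.inductionOn' with
    | h b => exact congrArg Quotient.mk'' (SimpleGraph.Dart.symm_symm b)

/-- The quotient map on vertices. -/
def quotV (v : V) : (quotientGraph T G).V := (Quotient.mk'' v : MulAction.orbitRel.Quotient G V)

/-- The quotient map on arcs. -/
def quotA (b : T.Dart) : (quotientGraph T G).A :=
  (Quotient.mk'' b : MulAction.orbitRel.Quotient G T.Dart)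

theorem quotV_eq_iff (v w : V) : quotV T G v = quotV T G w ↔ ∃ g ∈ G, g w = v := by
  refine Quotient.eq''.trans ⟨?_, ?_⟩
  · rintro ⟨g, hg⟩
    exact ⟨g.1, g.2, hg⟩
  · rintro ⟨g, hg, h⟩
    exact ⟨⟨g, hg⟩, h⟩

theorem quotA_eq_iff (b c : T.Dart) : quotA T G b = quotA T G c ↔ ∃ g ∈ G, g • c = b := by
  refine Quotient.eq''.trans ⟨?_, ?_⟩
  · rintro ⟨g, hg⟩
    exact ⟨g.1, g.2, hg⟩
  · rintro ⟨g, hg, h⟩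
    exact ⟨⟨g, hg⟩, h⟩

theorem quotV_surjective : Function.Surjective (quotV T G) := Quotient.mk''_surjective

theorem quotA_surjective : Function.Surjective (quotA T G) := Quotient.mk''_surjective

theorem quot_o (b : T.Dart) : (quotientGraph T G).o (quotA T G b) = quotV T G b.fst := rfl

theorem quot_r (b : T.Dart) : (quotientGraph T G).r (quotA T G b) = quotA T G b.symm := rfl

theorem quotientGraph_connected (hT : T.IsTree) : (quotientGraph T G).Connected := by
  obtain ⟨v₀⟩ := hT.connected.nonempty
  refine ⟨⟨quotV T G v₀⟩, fun x y => ?_⟩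
  obtain ⟨v, rfl⟩ := quotV_surjective T G x
  obtain ⟨w, rfl⟩ := quotV_surjective T G y
  obtain ⟨p⟩ := hT.connected.preconnected v w
  induction p with
  | nil => exact Relation.ReflTransGen.refl
  | cons h p ih =>
    exact Relation.ReflTransGen.head ⟨quotA T G ⟨(_, _), h⟩, rfl, rfl⟩ ih

/-- The choices made in the construction of the local action diagram of `(T, G)`: a representative
`star v` of each vertex `v` of the quotient graph, and for each vertex `w` of `T` an element
`toStar w` of `G` that takes `w` to the chosen representative of its orbit. -/
structure AssociatedChoice where
  star : (quotientGraph T G).V → V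
  quotV_star : ∀ v, quotV T G (star v) = v
  toStar : V → (T ≃g T)
  toStar_mem : ∀ w, toStar w ∈ G
  toStar_apply : ∀ w, toStar w w = star (quotV T G w)

instance : Nonempty (AssociatedChoice T G) := by
  have h1 : ∀ v, ∃ w, quotV T G w = v := quotV_surjective T G
  choose s hs using h1
  have h2 : ∀ w, ∃ g ∈ G, g w = s (quotV T G w) := fun w => (quotV_eq_iff T G _ _).1 (hs _)
  choose g hg hg' using h2
  exact ⟨⟨s, hs, g, hg, hg'⟩⟩

namespace AssociatedChoice

variable {T G} (κ : AssociatedChoice T G)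

/-- The colour set of an arc `a` of the quotient graph: the arcs of `T` that lie over `a` and
originate at the chosen representative of the origin of `a`. -/
abbrev X (a : (quotientGraph T G).A) : Type u :=
  {b : T.Dart // b.fst = κ.star ((quotientGraph T G).o a) ∧ quotA T G b = a}

/-- The permutation group induced by the stabilizer in `G` of the representative `star v` on the
set `X_v`, which is the set of arcs of `T` originating at `star v` (partitioned according to
their images in the quotient graph). -/
def inducedGroup (v : (quotientGraph T G).V) :
    Subgroup (Equiv.Perm ((quotientGraph T G).ColoursAt κ.X v)) where
  carrier := {σ | ∃ g ∈ G, g (κ.star v) = κ.star v ∧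
    ∀ c, (σ c).1.2.1 = g • c.1.2.1}
  mul_mem' := by
    rintro σ τ ⟨g, hg, hg1, hg2⟩ ⟨h, hh, hh1, hh2⟩
    refine ⟨g * h, G.mul_mem hg hh, ?_, fun c => ?_⟩
    · rw [RelIso.mul_apply, hh1, hg1]
    · rw [Equiv.Perm.mul_apply, hg2, hh2, mul_smul]
  one_mem' := ⟨1, G.one_mem, rfl, fun _ => rfl⟩
  inv_mem' := by
    rintro σ ⟨g, hg, hg1, hg2⟩
    refine ⟨g⁻¹, G.inv_mem hg, ?_, fun c => ?_⟩
    · apply g.injective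
      rw [RelIso.apply_inv_self, hg1]
    · rw [eq_inv_smul_iff, ← hg2, Equiv.Perm.coe_inv, Equiv.apply_symm_apply]

theorem colour_ext {v : (quotientGraph T G).V} {c d : (quotientGraph T G).ColoursAt κ.X v}
    (h : c.1.2.1 = d.1.2.1) : c = d := by
  obtain ⟨⟨a, b, hb, rfl⟩, hc⟩ := c
  obtain ⟨⟨a', b', hb', rfl⟩, hd⟩ := d
  change b = b' at h
  subst h
  rfl

/-- An element of the stabilizer of `star v`, as a permutation of `X_v`. -/
def stabPerm (v : (quotientGraph T G).V) (g : T ≃g T) (hg : g ∈ G)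
    (hv : g (κ.star v) = κ.star v) : Equiv.Perm ((quotientGraph T G).ColoursAt κ.X v) where
  toFun c := ⟨⟨c.1.1, g • c.1.2.1, by rw [smul_fst, c.1.2.2.1, c.2, hv],
    ((quotA_eq_iff T G _ _).2 ⟨g, hg, rfl⟩).trans c.1.2.2.2⟩, c.2⟩
  invFun c := ⟨⟨c.1.1, g⁻¹ • c.1.2.1, by
      rw [smul_fst, c.1.2.2.1, c.2]
      apply g.injective
      rw [RelIso.apply_inv_self, hv],
    ((quotA_eq_iff T G _ _).2 ⟨g⁻¹, G.inv_mem hg, rfl⟩).trans c.1.2.2.2⟩, c.2⟩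
  left_inv c := κ.colour_ext (inv_smul_smul g c.1.2.1)
  right_inv c := κ.colour_ext (smul_inv_smul g c.1.2.1)

theorem inducedGroup_orbits (v : (quotientGraph T G).V)
    (c d : (quotientGraph T G).ColoursAt κ.X v) :
    (∃ σ ∈ permClosure (κ.inducedGroup v), σ c = d) ↔ c.1.1 = d.1.1 := by
  constructor
  · rintro ⟨σ, hσ, rfl⟩
    obtain ⟨τ, ⟨g, hg, -, hg2⟩, hτ⟩ := (mem_permClosure_iff _ _).1 hσ {c}
    rw [← hτ c (Finset.mem_singleton_self c), ← c.1.2.2.2, ← (τ c).1.2.2.2, hg2]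
    exact ((quotA_eq_iff T G _ _).2 ⟨g, hg, rfl⟩).symm
  · intro h
    have h' : quotA T G d.1.2.1 = quotA T G c.1.2.1 := by rw [d.1.2.2.2, c.1.2.2.2, h]
    obtain ⟨g, hg, hgd⟩ := (quotA_eq_iff T G _ _).1 h'
    have hc : c.1.2.1.fst = κ.star v := c.1.2.2.1.trans (congrArg κ.star c.2)
    have hd : d.1.2.1.fst = κ.star v := d.1.2.2.1.trans (congrArg κ.star d.2)
    have hv : g (κ.star v) = κ.star v := by
      rw [← hc, ← smul_fst, hgd, hd, hc]
    refine ⟨κ.stabPerm v g hg hv, (mem_permClosure_iff _ _).2 fun F =>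
      ⟨_, ⟨g, hg, hv, fun _ => rfl⟩, fun _ _ => rfl⟩, κ.colour_ext hgd⟩

theorem nonempty_X (a : (quotientGraph T G).A) : Nonempty (κ.X a) := by
  obtain ⟨b, rfl⟩ := quotA_surjective T G a
  refine ⟨⟨κ.toStar b.fst • b, ?_, (quotA_eq_iff T G _ _).2 ⟨_, κ.toStar_mem _, rfl⟩⟩⟩
  rw [smul_fst, κ.toStar_apply, quot_o]

/-- The local action diagram associated to `(T, G)`: the quotient graph, together with the
closures in `Sym(X_v)` of the permutation groups induced by vertex stabilizers. -/
def diagram (hT : T.IsTree) : LocalActionDiagram.{u} where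
  Γ := quotientGraph T G
  connected := quotientGraph_connected T G hT
  X := κ.X
  nonempty_X := κ.nonempty_X
  G v := permClosure (κ.inducedGroup v)
  closed_G _ := @isClosed_closure _ (permTopology _) _
  orbits_G := κ.inducedGroup_orbits

/-- The associated structure of a tree over `κ.diagram hT` on `T`: the colour of an arc `b`
originating at `w` is its image under the chosen element `toStar w` of `G`. -/
def deltaTree (hT : T.IsTree) : DeltaTree (κ.diagram hT) T where
  isTree := hT
  πV := quotV T G
  πA := quotA T G
  map_o _ := rfl
  map_r _ := rfl
  πV_surjective := quotV_surjective T G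
  πA_surjective := quotA_surjective T G
  L b := ⟨quotA T G b, κ.toStar b.fst • b, by
      rw [smul_fst, κ.toStar_apply, quot_o],
    (quotA_eq_iff T G _ _).2 ⟨_, κ.toStar_mem _, rfl⟩⟩
  L_bijOn := by
    intro v a ha
    refine ⟨fun b hb => hb.2, ?_, ?_⟩
    · rintro b ⟨rfl, rfl⟩ b' ⟨hv, ha'⟩ h
      have h2 : κ.toStar b.fst • b = κ.toStar b'.fst • b' := by
        have := congrArg (fun c : Σ a, κ.X a => c.2.1) h
        exact this
      rw [hv] at h2
      exact smul_left_cancel _ h2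
    · rintro ⟨a', b, hb, hba⟩ (rfl : a' = a)
      change (quotientGraph T G).o a' = quotV T G v at ha
      have hfst : ((κ.toStar v)⁻¹ • b).fst = v := by
        rw [smul_fst, hb, ha, ← κ.toStar_apply, RelIso.inv_apply_self]
      have hq : quotA T G ((κ.toStar v)⁻¹ • b) = a' :=
        ((quotA_eq_iff T G _ _).2 ⟨_, G.inv_mem (κ.toStar_mem v), rfl⟩).trans hba
      refine ⟨(κ.toStar v)⁻¹ • b, ⟨hfst, hq⟩, ?_⟩
      subst hq
      refine Sigma.ext rfl (heq_of_eq (Subtype.ext ?_))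
      change κ.toStar ((κ.toStar v)⁻¹ • b).fst • (κ.toStar v)⁻¹ • b = b
      rw [hfst, smul_inv_smul]

end AssociatedChoice

end Associated

end LocalActionTree

open LocalActionTree

/-!
# Groups acting on trees with property P and local action diagrams

Everything rests on two facts about trees.

*Local data extend* (`exists_iso_of_local`). Suppose that maps between the neighbours of vertices
of two trees are bijective, and that each of them can be continued across every edge. Then such a
map at one vertex extends to a locally bijective map of trees, by recursion on the distance from
that vertex, and locally bijective maps between trees are isomorphisms. For two `Δ`-trees,
continuing across an edge amounts to finding an element of `G(v)` with a given value at one colour,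
which exists because the orbits of `G(v)` are the colour sets `X_a`. So any local action prescribed
at one vertex is realized (`DeltaTree.exists_isLocalIso`). Hence `Δ`-trees are unique, the orbits
of the universal group are the fibres of the projection, and a stabilizer induces the whole of
`G(v)`; that is, the diagram associated to the universal group is `Δ` again
(`DeltaTree.nonempty_iso_diagram`).

*Property P is a condition on balls of radius one.* A group that contains every automorphism
agreeing with its elements on finite subsets of such balls has property P, since an automorphism
glued along a path agrees with one of its pieces near each vertex
(`hasPropertyP_of_pkClosure_le`). Conversely, in a `P`-closed group an approximation on a finite
connected set can be corrected at one further leaf, by applying property P to the finitely many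
edges of the set at the neighbour of the leaf (`HasPropertyP.pkClosure_le`). Universal groups
satisfy the former condition because the groups `G(v)` are closed, and the universal group of the
diagram associated to `G` is the `P₁`-closure of `G`
(`AssociatedChoice.universalGroup_eq_pkClosure`). So a `P`-closed group is the universal group of
its diagram, which makes the correspondence bijective.

A tree over `Δ` is built from the coloured paths in `Δ` without steps back, where a fixed colour in
each `X_a` marks the step back (`LocalActionDiagram.exists_deltaTree`).
-/

namespace LocalActionTree

/-! ### Distances in trees -/

section Tree

variable {V W : Type*} {T : SimpleGraph V} {T' : SimpleGraph W}

theorem exists_adj_dist_add_one (hT : T.Connected) {r v : V} (h : v ≠ r) :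
    ∃ u, T.Adj v u ∧ T.dist r v = T.dist r u + 1 := by
  obtain ⟨p, hp⟩ := hT.exists_walk_length_eq_dist v r
  cases p with
  | nil => exact absurd rfl h
  | @cons _ u _ hvu q =>
    refine ⟨u, hvu, ?_⟩
    rw [SimpleGraph.Walk.length_cons, T.dist_comm] at hp
    have h1 : T.dist r u ≤ q.length := T.dist_comm (u := r) ▸ T.dist_le q
    have h2 : T.dist r v ≤ T.dist r u + T.dist u v := hT.dist_triangle
    rw [SimpleGraph.dist_eq_one_iff_adj.2 hvu.symm] at h2
    omega

/-- In a tree rooted at `r`, a vertex has only one parent. -/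
theorem eq_of_adj_of_dist_add_one (hT : T.IsTree) {r v u u' : V} (hu : T.Adj v u)
    (hu' : T.Adj v u') (h : T.dist r v = T.dist r u + 1) (h' : T.dist r v = T.dist r u' + 1) :
    u = u' := by
  obtain ⟨p, hp⟩ := hT.connected.exists_walk_length_eq_dist r u
  obtain ⟨q, hq⟩ := hT.connected.exists_walk_length_eq_dist r u'
  have hp' : (p.concat hu.symm).IsPath :=
    SimpleGraph.Walk.isPath_of_length_eq_dist _ (by rw [SimpleGraph.Walk.length_concat, hp, h])
  have hq' : (q.concat hu'.symm).IsPath :=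
    SimpleGraph.Walk.isPath_of_length_eq_dist _ (by rw [SimpleGraph.Walk.length_concat, hq, h'])
  have := congrArg Subtype.val ((hT.isAcyclic.subsingleton_path r v).elim ⟨_, hp'⟩ ⟨_, hq'⟩)
  simpa using congrArg SimpleGraph.Walk.penultimate this

/-- A map between trees that is bijective on the neighbours of every vertex is bijective. -/
theorem bijective_of_bijOn_neighborSet (hT : T.IsTree) (hT' : T'.IsTree) {g : V → W}
    (hg : ∀ v, Set.BijOn g (T.neighborSet v) (T'.neighborSet (g v))) : Function.Bijective g := by
  obtain ⟨r⟩ := hT.connected.nonempty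
  have hadj {v u : V} (h : T.Adj v u) : T'.Adj (g v) (g u) := (hg v).mapsTo h
  -- The map preserves the distance from the root and takes parents to parents.
  have key : ∀ n v, T.dist r v = n → T'.dist (g r) (g v) = n ∧
      ∀ u, T.Adj v u → T.dist r u = n + 1 → T'.dist (g r) (g u) = n + 1 := by
    intro n
    induction n with
    | zero =>
      intro v hv
      obtain rfl := hT.connected.dist_eq_zero_iff.1 hv
      refine ⟨by simp, fun u hu _ => ?_⟩
      rw [zero_add]
      exact SimpleGraph.dist_eq_one_iff_adj.2 (hadj hu)
    | succ n ih =>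
      intro v hv
      have hvr : v ≠ r := by rintro rfl; simp at hv
      obtain ⟨p, hvp, hp⟩ := exists_adj_dist_add_one hT.connected hvr
      have hpn : T.dist r p = n := by omega
      have hgv := (ih p hpn).2 v hvp.symm hv
      refine ⟨hgv, fun u hu hun => ?_⟩
      rcases hT'.dist_eq_dist_add_one_of_adj (g r) (hadj hu) with h | h
      · exfalso
        have h1 := eq_of_adj_of_dist_add_one hT' (hadj hvp) (hadj hu)
          (by rw [hgv, (ih p hpn).1]) h
        have := (hg v).injOn hvp hu h1
        subst this
        omega
      · omega
  have inj : ∀ n v v', T.dist r v = n → g v = g v' → v = v' := by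
    intro n
    induction n with
    | zero =>
      intro v v' hv h
      have h2 := (key _ v' rfl).1
      rw [← h, (key _ v hv).1] at h2
      rw [← hT.connected.dist_eq_zero_iff.1 hv, ← hT.connected.dist_eq_zero_iff.1 h2.symm]
    | succ n ih =>
      intro v v' hv h
      have hv' : T.dist r v' = n + 1 := by rw [← (key _ v' rfl).1, ← h, (key _ v hv).1]
      obtain ⟨p, hvp, hp⟩ := exists_adj_dist_add_one hT.connected
        (show v ≠ r by rintro rfl; simp at hv)
      obtain ⟨p', hvp', hp'⟩ := exists_adj_dist_add_one hT.connected
        (show v' ≠ r by rintro rfl; simp at hv')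
      have h1 : g p = g p' := by
        refine eq_of_adj_of_dist_add_one hT' (r := g r) (hadj hvp) (h ▸ hadj hvp') ?_ ?_
        · rw [(key _ v rfl).1, (key _ p rfl).1, hp]
        · rw [(key _ v rfl).1, (key _ p' rfl).1, hv, ← hv', hp']
      obtain rfl := ih p p' (by omega) h1
      exact (hg p).injOn hvp.symm hvp'.symm h
  refine ⟨fun v v' h => inj _ v v' rfl h, fun w => ?_⟩
  obtain ⟨p⟩ := hT'.connected.preconnected w (g r)
  have surj : ∀ (w w' : W), T'.Walk w w' → w' ∈ Set.range g → w ∈ Set.range g := by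
    intro w w' p
    induction p with
    | nil => exact id
    | cons h p ih =>
      intro h'
      obtain ⟨v, rfl⟩ := ih h'
      obtain ⟨u, -, hu⟩ := (hg v).surjOn h.symm
      exact ⟨u, hu⟩
  exact surj _ _ p ⟨r, rfl⟩

/-- Local data on a tree extend to an isomorphism. Here `C v w f` is a condition on a map `f`
from the neighbours of `v` to the neighbours of `w` (the values of `f` elsewhere are irrelevant).
If every admissible `f` is bijective and can be continued across each edge, then every admissible
`f₀` is the restriction of an isomorphism that is admissible at all vertices. -/
theorem exists_iso_of_local (hT : T.IsTree) (hT' : T'.IsTree) (C : V → W → (V → W) → Prop)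
    (hbij : ∀ v w f, C v w f → Set.BijOn f (T.neighborSet v) (T'.neighborSet w))
    (hext : ∀ v w f, C v w f → ∀ u, T.Adj v u → ∃ f', C u (f u) f' ∧ f' v = w)
    {v₀ : V} {w₀ : W} {f₀ : V → W} (h₀ : C v₀ w₀ f₀) :
    ∃ g : T ≃g T', g v₀ = w₀ ∧ (∀ u, T.Adj v₀ u → g u = f₀ u) ∧
      ∀ v, ∃ f, C v (g v) f ∧ ∀ u, T.Adj v u → g u = f u := by
  classical
  have hstep : ∀ v u w f, ∃ f', C v w f → T.Adj v u → C u (f u) f' ∧ f' v = w := by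
    intro v u w f
    by_cases h : C v w f ∧ T.Adj v u
    · obtain ⟨f', hf'⟩ := hext v w f h.1 u h.2
      exact ⟨f', fun _ _ => hf'⟩
    · exact ⟨f, fun h1 h2 => absurd ⟨h1, h2⟩ h⟩
  choose step hstep using hstep
  have hparent : ∀ v, ∃ p, v ≠ v₀ → T.Adj v p ∧ T.dist v₀ v = T.dist v₀ p + 1 := by
    intro v
    by_cases h : v = v₀
    · exact ⟨v, fun h' => absurd h h'⟩
    · obtain ⟨p, hp⟩ := exists_adj_dist_add_one hT.connected h
      exact ⟨p, fun _ => hp⟩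
  choose p hp using hparent
  -- The image of `v` and the map on its neighbours, by recursion on the distance from `v₀`.
  let F : ℕ → V → W × (V → W) := fun n => Nat.rec (fun _ => (w₀, f₀))
    (fun _ F v => ((F (p v)).2 v, step (p v) v (F (p v)).1 (F (p v)).2)) n
  let D : V → W × (V → W) := fun v => F (T.dist v₀ v) v
  have hD₀ : D v₀ = (w₀, f₀) := by simp [D, F]
  have hD : ∀ v, v ≠ v₀ →
      D v = ((D (p v)).2 v, step (p v) v (D (p v)).1 (D (p v)).2) := by
    intro v hv
    simp only [D]
    rw [(hp v hv).2]
  have hC : ∀ n v, T.dist v₀ v = n → C v (D v).1 (D v).2 := by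
    intro n
    induction n with
    | zero =>
      intro v hv
      obtain rfl := hT.connected.dist_eq_zero_iff.1 hv
      rw [hD₀]
      exact h₀
    | succ n ih =>
      intro v hv
      have hv₀ : v ≠ v₀ := by rintro rfl; simp at hv
      rw [hD v hv₀]
      exact (hstep _ _ _ _ (ih (p v) (by have := (hp v hv₀).2; omega)) (hp v hv₀).1.symm).1
  have hup : ∀ v, v ≠ v₀ → (D v).1 = (D (p v)).2 v ∧ (D v).2 (p v) = (D (p v)).1 := by
    intro v hv
    rw [hD v hv]
    exact ⟨rfl, (hstep _ _ _ _ (hC _ (p v) rfl) (hp v hv).1.symm).2⟩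
  have hloc : ∀ v u, T.Adj v u → (D u).1 = (D v).2 u := by
    intro v u hvu
    rcases hT.dist_eq_dist_add_one_of_adj v₀ hvu with h | h
    · have hv : v ≠ v₀ := by rintro rfl; simp at h
      obtain rfl := eq_of_adj_of_dist_add_one hT (hp v hv).1 hvu (hp v hv).2 h
      exact (hup v hv).2.symm
    · have hu : u ≠ v₀ := by rintro rfl; simp at h
      obtain rfl := eq_of_adj_of_dist_add_one hT (hp u hu).1 hvu.symm (hp u hu).2 h
      exact (hup u hu).1
  have hb : ∀ v, Set.BijOn (fun v => (D v).1) (T.neighborSet v) (T'.neighborSet (D v).1) :=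
    fun v => (hbij _ _ _ (hC _ v rfl)).congr fun u hu => (hloc v u hu).symm
  have hbb := bijective_of_bijOn_neighborSet hT hT' hb
  refine ⟨⟨Equiv.ofBijective _ hbb, ?_⟩, ?_, ?_, ?_⟩
  · intro v u
    refine ⟨fun h => ?_, fun h => (hb v).mapsTo h⟩
    obtain ⟨u', hu', hu⟩ := (hb v).surjOn h
    rwa [← hbb.1 hu]
  · exact congrArg Prod.fst hD₀
  · intro u hu
    exact (hloc _ _ hu).trans (by rw [hD₀])
  · exact fun v => ⟨(D v).2, hC _ v rfl, fun u hu => hloc v u hu⟩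

/-! ### Closest point projections onto connected sets -/

/-- The set `L` spans a connected subgraph: any two of its elements are joined by a path inside
`L`. -/
def SpansConnected (T : SimpleGraph V) (L : Set V) : Prop :=
  ∀ x ∈ L, ∀ y ∈ L, Relation.ReflTransGen (fun a b => T.Adj a b ∧ b ∈ L) x y

/-- If `x` is the point of the connected set `L` closest to `w`, then paths from `w` to `L` pass
through `x`. -/
theorem dist_eq_add_of_forall_le (hT : T.IsTree) {L : Set V} (hL : SpansConnected T L) {w x y : V}
    (hx : x ∈ L) (hw : ∀ y ∈ L, T.dist w x ≤ T.dist w y) (hy : y ∈ L) :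
    T.dist w y = T.dist w x + T.dist x y := by
  have h := hL x hx y hy
  induction h with
  | refl => simp
  | @tail y z hxy hyz ih =>
    have hyL : y ∈ L := by
      rcases hxy.cases_tail with rfl | ⟨_, _, h⟩
      exacts [hx, h.2]
    have hwy := ih hyL
    have htri : T.dist w z ≤ T.dist w x + T.dist x z := hT.connected.dist_triangle
    rcases hT.dist_eq_dist_add_one_of_adj w hyz.1 with h1 | h1 <;>
      rcases hT.dist_eq_dist_add_one_of_adj x hyz.1 with h2 | h2
    · omega
    · exfalso
      -- Both `z` and the parent of `y` towards `x` are the parent of `y` towards `w`.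
      have hyx : y ≠ x := by
        rintro rfl
        have := hw z hyz.2
        omega
      obtain ⟨u, hyu, hu⟩ := exists_adj_dist_add_one hT.connected hyx
      have h3 : T.dist w u ≤ T.dist w x + T.dist x u := hT.connected.dist_triangle
      have h4 : T.dist w y = T.dist w u + 1 := by
        rcases hT.dist_eq_dist_add_one_of_adj w hyu with h | h <;> omega
      have := eq_of_adj_of_dist_add_one hT hyu hyz.1 h4 h1
      subst this
      omega
    · omega
    · omega

theorem exists_mem_projFibre {V : Type*} (T : SimpleGraph V) {L : Set V} (hL : L.Nonempty)
    (w : V) : ∃ x : L, ∀ y ∈ L, T.dist w x ≤ T.dist w y := by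
  classical
  have hne : (T.dist w '' L).Nonempty := hL.image _
  obtain ⟨x, hx, h⟩ := Nat.sInf_mem hne
  refine ⟨⟨x, hx⟩, fun y hy => ?_⟩
  rw [h]
  exact Nat.sInf_le ⟨y, hy, rfl⟩

theorem projFibre_unique (hT : T.IsTree) {L : Set V} (hL : SpansConnected T L) {w x x' : V}
    (hx : x ∈ L) (hx' : x' ∈ L) (hw : ∀ y ∈ L, T.dist w x ≤ T.dist w y)
    (hw' : ∀ y ∈ L, T.dist w x' ≤ T.dist w y) : x = x' := by
  have h1 := dist_eq_add_of_forall_le hT hL hx hw hx'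
  have h2 := hw' x hx
  exact hT.connected.dist_eq_zero_iff.1 (by omega)

/-- Neighbours of a vertex outside `L` have the same closest point in `L`. -/
theorem projFibre_of_adj (hT : T.IsTree) {L : Set V} (hL : SpansConnected T L) {v w x : V}
    (hx : x ∈ L) (hv : ∀ y ∈ L, T.dist v x ≤ T.dist v y) (hvL : v ∉ L) (hvw : T.Adj v w) :
    ∀ y ∈ L, T.dist w x ≤ T.dist w y := by
  intro y hy
  have hne : v ≠ x := by rintro rfl; exact hvL hx
  obtain ⟨u, hvu, hu⟩ := exists_adj_dist_add_one hT.connected hne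
  have h1 := dist_eq_add_of_forall_le hT hL hx hv hy
  have h2 : T.dist y u ≤ T.dist y x + T.dist x u := hT.connected.dist_triangle
  rw [T.dist_comm (u := w), T.dist_comm (u := w)]
  rw [T.dist_comm (u := v), T.dist_comm (u := v)] at h1
  rw [T.dist_comm (u := y) (v := x)] at h2
  rcases hT.dist_eq_dist_add_one_of_adj x hvw with h3 | h3 <;>
    rcases hT.dist_eq_dist_add_one_of_adj y hvw with h4 | h4
  · omega
  · omega
  · -- Towards `y`, both `w` and `u` are the parent of `v`, but `w` is not so towards `x`.
    have h5 : T.dist y v = T.dist y u + 1 := by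
      rcases hT.dist_eq_dist_add_one_of_adj y hvu with h | h <;> omega
    have := eq_of_adj_of_dist_add_one hT hvu hvw h5 h4
    subst this
    omega
  · omega

/-- A connected set that contains two vertices contains the edge by which the path from one to
the other starts. -/
theorem mem_of_adj_of_dist_lt (hT : T.IsTree) {L : Set V} (hL : SpansConnected T L) {v u x : V}
    (hv : v ∈ L) (hx : x ∈ L) (hvu : T.Adj v u) (h : T.dist u x < T.dist v x) : u ∈ L := by
  obtain ⟨⟨z, hz⟩, hzu⟩ := exists_mem_projFibre T ⟨v, hv⟩ u
  have h1 := dist_eq_add_of_forall_le hT hL hz hzu hv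
  have h2 := dist_eq_add_of_forall_le hT hL hz hzu hx
  rw [SimpleGraph.dist_eq_one_iff_adj.2 hvu.symm] at h1
  rcases Nat.eq_zero_or_pos (T.dist u z) with h3 | h3
  · rwa [hT.connected.dist_eq_zero_iff.1 h3]
  · have : z = v := hT.connected.dist_eq_zero_iff.1 (by omega)
    subst this
    omega

end Tree

theorem IsPathSet.spansConnected {V : Type*} {T : SimpleGraph V} {L : Set V}
    (h : IsPathSet T L) : SpansConnected T L := by
  obtain ⟨I, p, -, hI, -, hadj, rfl⟩ := h
  have key : ∀ i ∈ I, ∀ n : ℕ, i + n ∈ I →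
      Relation.ReflTransGen (fun a b => T.Adj a b ∧ b ∈ p '' I) (p i) (p (i + n)) ∧
      Relation.ReflTransGen (fun a b => T.Adj a b ∧ b ∈ p '' I) (p (i + n)) (p i) := by
    intro i hi n
    induction n with
    | zero => simpa using fun _ => Relation.ReflTransGen.refl
    | succ n ih =>
      intro hn
      have hn' : i + n ∈ I := hI.out hi hn ⟨by omega, by push_cast; omega⟩
      have ha : T.Adj (p (i + n)) (p (i + (n + 1 : ℕ))) := by
        have := hadj (i + n) hn' (by rw [add_assoc]; exact_mod_cast hn)
        rwa [add_assoc] at this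
      obtain ⟨h1, h2⟩ := ih hn'
      exact ⟨h1.tail ⟨ha, _, hn, rfl⟩, .head ⟨ha.symm, _, hn', rfl⟩ h2⟩
  rintro _ ⟨i, hi, rfl⟩ _ ⟨j, hj, rfl⟩
  rcases le_total i j with hij | hij
  · have := (key i hi (j - i).toNat (by rw [Int.toNat_of_nonneg (by omega)]; simpa)).1
    rwa [Int.toNat_of_nonneg (by omega), add_sub_cancel] at this
  · have := (key j hj (i - j).toNat (by rw [Int.toNat_of_nonneg (by omega)]; simpa)).2
    rwa [Int.toNat_of_nonneg (by omega), add_sub_cancel] at this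

/-! ### Property P and the closure `pkClosure` for radius one -/

section PropertyP

variable {V : Type u} {T : SimpleGraph V}

theorem mem_autClosure_iff (S : Set (T ≃g T)) (g : T ≃g T) :
    g ∈ @closure _ (autTopology T) S ↔ ∀ F : Finset V, ∃ h ∈ S, ∀ x ∈ F, h x = g x := by
  let _ : TopologicalSpace (Equiv.Perm V) := permTopology V
  rw [closure_induced, mem_permClosure_iff]
  simp

theorem le_pkClosure (hT : T.IsTree) (k : ℕ) (G : Subgroup (T ≃g T)) : G ≤ pkClosure T hT k G :=
  fun g hg _ _ _ => ⟨g, hg, fun _ _ => rfl⟩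

theorem pkClosure_mono (hT : T.IsTree) (k : ℕ) {G H : Subgroup (T ≃g T)} (h : G ≤ H) :
    pkClosure T hT k G ≤ pkClosure T hT k H := fun _ hg v F hF =>
  let ⟨a, ha, hF⟩ := hg v F hF
  ⟨a, h ha, hF⟩

/-- An automorphism glued from automorphisms `s x` fixing a connected set `L`, where `s x` is used
on the fibre of the closest point projection over `x ∈ L`. Around every vertex, it agrees with one
of the `s x`. -/
theorem exists_glued (hT : T.IsTree) {L : Set V} (hne : L.Nonempty) (hL : SpansConnected T L)
    (s : L → (T ≃g T)) (hs : ∀ x, ∀ y ∈ L, s x y = y) :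
    ∃ g : T ≃g T, (∀ y ∈ L, g y = y) ∧ (∀ x : L, ∀ w ∈ projFibre T L x, g w = s x w) ∧
      ∀ v, ∃ x, ∀ w, v = w ∨ T.Adj v w → g w = s x w := by
  choose q hq using exists_mem_projFibre T hne
  have hqu (x : L) (w : V) (hw : w ∈ projFibre T L x) : q w = x :=
    Subtype.ext (projFibre_unique hT hL (q w).2 x.2 (hq w) hw)
  have hqL (y : V) (hy : y ∈ L) : q y = ⟨y, hy⟩ := hqu ⟨y, hy⟩ y fun z _ => by simp
  -- If `a` fixes `L` pointwise then it commutes with the projection.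
  have hqa (a : T ≃g T) (ha : ∀ y ∈ L, a y = y) (w : V) : q (a w) = q w := by
    refine hqu _ _ fun y hy => ?_
    have h1 := dist_map T a hT.connected w (q w)
    have h2 := dist_map T a hT.connected w y
    rw [ha _ (q w).2] at h1
    rw [ha y hy] at h2
    rw [h1, h2]
    exact hq w y hy
  have hsymm (x : L) (y : V) (hy : y ∈ L) : (s x).symm y = y := by
    rw [RelIso.symm_apply_eq, hs x y hy]
  have hloc (s : L → (T ≃g T)) (hs : ∀ x, ∀ y ∈ L, s x y = y) (v : V) :
      ∀ w, v = w ∨ T.Adj v w → s (q w) w = s (q v) w := by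
    rintro w (rfl | h)
    · rfl
    · by_cases hv : v ∈ L
      · by_cases hw : w ∈ L
        · rw [hs _ w hw, hs _ w hw]
        · have := projFibre_of_adj hT hL (q w).2 (hq w) hw h.symm
          rw [hqu (q w) v this]
      · have := projFibre_of_adj hT hL (q v).2 (hq v) hv h
        rw [hqu (q v) w this]
  let e : V ≃ V :=
    { toFun w := s (q w) w
      invFun w := (s (q w)).symm w
      left_inv w := by
        change (s (q (s (q w) w))).symm (s (q w) w) = w
        rw [hqa _ (hs _), RelIso.symm_apply_apply]
      right_inv w := by
        change s (q ((s (q w)).symm w)) ((s (q w)).symm w) = w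
        rw [hqa _ (hsymm _), RelIso.apply_symm_apply] }
  have hadj {v w : V} (h : T.Adj v w) : T.Adj (e v) (e w) := by
    change T.Adj (s (q v) v) (s (q w) w)
    rw [hloc s hs v w (.inr h)]
    exact (s (q v)).map_rel_iff.2 h
  have hadj' {v w : V} (h : T.Adj v w) : T.Adj (e.symm v) (e.symm w) := by
    change T.Adj ((s (q v)).symm v) ((s (q w)).symm w)
    rw [hloc (fun x => (s x).symm) hsymm v w (.inr h)]
    exact (s (q v)).symm.map_rel_iff.2 h
  refine ⟨⟨e, fun {v w} => ⟨fun h => by simpa using hadj' h, hadj⟩⟩, fun y hy => hs _ y hy,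
    fun x w hw => ?_, fun v => ⟨q v, hloc s hs v⟩⟩
  change s (q w) w = s x w
  rw [hqu x w hw]

/-- A group that contains every automorphism which agrees with its elements on finite subsets of
balls of radius one has property P: automorphisms glued along a path belong to it. -/
theorem hasPropertyP_of_pkClosure_le (hT : T.IsTree) {H : Subgroup (T ≃g T)}
    (h : pkClosure T hT 1 H ≤ H) : HasPropertyP T H := by
  constructor
  · let _ : TopologicalSpace (T ≃g T) := autTopology T
    refine isClosed_of_closure_subset fun g hg => h fun v F _ => ?_
    obtain ⟨a, ha, hF⟩ := (mem_autClosure_iff _ _).1 hg F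
    exact ⟨a, ha, fun w hw => (hF w hw).symm⟩
  · intro L hL s hs
    have hne : L.Nonempty := by
      obtain ⟨I, p, hI, -, -, -, rfl⟩ := hL
      exact hI.image p
    obtain ⟨g, hg, hgs, hloc⟩ := exists_glued hT hne hL.spansConnected s fun x => (hs x).2
    refine ⟨g, h fun v F hF => ?_, hg, hgs⟩
    obtain ⟨x, hx⟩ := hloc v
    refine ⟨s x, (hs x).1, fun w hw => hx w ?_⟩
    rcases Nat.le_one_iff_eq_zero_or_eq_one.1 (hF w hw) with h0 | h1
    · exact .inl (hT.connected.dist_eq_zero_iff.1 h0)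
    · exact .inr (SimpleGraph.dist_eq_one_iff_adj.1 h1)

theorem isPathSet_pair {v u : V} (h : T.Adj v u) : IsPathSet T {v, u} := by
  refine ⟨Set.Icc 0 1, fun i => if i = 0 then v else u, ⟨0, by simp⟩, Set.ordConnected_Icc,
    ?_, ?_, ?_⟩
  · rintro i ⟨hi, hi'⟩ j ⟨hj, hj'⟩ hij
    have := h.ne
    obtain rfl | rfl : i = 0 ∨ i = 1 := by omega
    all_goals obtain rfl | rfl : j = 0 ∨ j = 1 := by omega
    all_goals simp_all
  · rintro i ⟨hi, hi'⟩ ⟨hj, hj'⟩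
    obtain rfl : i = 0 := by omega
    simpa using h
  · have : Set.Icc (0 : ℤ) 1 = {0, 1} := by ext; simp; omega
    rw [this, Set.image_pair]
    simp

/-- Property P for the edge from `v` to `u`: an element of `H` fixing both ends can be replaced
by the identity on the side of `u`. -/
theorem HasPropertyP.exists_trivial_beyond {H : Subgroup (T ≃g T)} (hH : HasPropertyP T H)
    {v u : V} (hvu : T.Adj v u) {s : T ≃g T} (hs : s ∈ H) (hv : s v = v) (hu : s u = u) :
    ∃ s' ∈ H, (∀ w, T.dist w u ≤ T.dist w v → s' w = w) ∧
      ∀ w, T.dist w v ≤ T.dist w u → s' w = s w := by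
  classical
  obtain ⟨g, hg, -, hgs⟩ := hH.2 {v, u} (isPathSet_pair hvu)
    (fun x => if x.1 = v then s else 1) (by
      rintro ⟨x, hx⟩
      dsimp only
      split_ifs
      · exact ⟨hs, by simp [hv, hu]⟩
      · exact ⟨H.one_mem, fun _ _ => rfl⟩)
  refine ⟨g, hg, fun w hw => ?_, fun w hw => ?_⟩
  · rw [hgs ⟨u, by simp⟩ w (by simpa [projFibre] using hw), if_neg hvu.ne']
    rfl
  · rw [hgs ⟨v, by simp⟩ w (by simpa [projFibre] using hw), if_pos rfl]

/-- Iteration of `HasPropertyP.exists_trivial_beyond` over finitely many edges at `v`. -/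
theorem HasPropertyP.exists_trivial_beyond_finset (hT : T.IsTree) {H : Subgroup (T ≃g T)}
    (hH : HasPropertyP T H) {v : V} {s : T ≃g T} (hs : s ∈ H) (hv : s v = v) (N : Finset V)
    (hN : ∀ u ∈ N, T.Adj v u ∧ s u = u) :
    ∃ s' ∈ H, (∀ u ∈ N, ∀ w, T.dist w u < T.dist w v → s' w = w) ∧
      ∀ w, (∀ u ∈ N, T.dist w v < T.dist w u) → s' w = s w := by
  classical
  induction N using Finset.induction_on with
  | empty => exact ⟨s, hs, by simp⟩
  | insert u N hu ih =>
    obtain ⟨s', hs', h1, h2⟩ := ih fun x hx => hN x (Finset.mem_insert_of_mem hx)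
    obtain ⟨hvu, hsu⟩ := hN u (Finset.mem_insert_self _ _)
    have hone {x : V} (hx : x ∈ insert u N) : T.dist x v = 1 :=
      SimpleGraph.dist_eq_one_iff_adj.2 (hN x hx).1.symm
    have hv' : s' v = v := by
      rw [h2 v fun x hx => ?_, hv]
      rw [T.dist_self, T.dist_comm, hone (Finset.mem_insert_of_mem hx)]
      exact one_pos
    have hu' : s' u = u := by
      rw [h2 u fun x hx => ?_, hsu]
      have hxv := (hN x (Finset.mem_insert_of_mem hx)).1
      have hux : 0 < T.dist u x := hT.connected.pos_dist_of_ne (by rintro rfl; exact hu hx)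
      rcases hT.dist_eq_dist_add_one_of_adj u hxv with h | h <;>
        rw [hone (Finset.mem_insert_self _ _)] at h ⊢ <;> omega
    obtain ⟨g, hg, h3, h4⟩ := hH.exists_trivial_beyond hvu hs' hv' hu'
    refine ⟨g, hg, fun x hx w hw => ?_, fun w hw => ?_⟩
    · by_cases hwu : T.dist w u ≤ T.dist w v
      · exact h3 w hwu
      · rcases Finset.mem_insert.1 hx with rfl | hx
        · omega
        · rw [h4 w (by omega), h1 x hx w hw]
    · rw [h4 w (hw u (Finset.mem_insert_self _ _)).le,
        h2 w fun x hx => hw x (Finset.mem_insert_of_mem hx)]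

/-- A `P`-closed group contains every automorphism that agrees with its elements on finite subsets
of balls of radius one. The automorphism is approximated on finite connected sets, which grow by
one leaf at a time; property P corrects the image of the new leaf without changing the rest. -/
theorem HasPropertyP.pkClosure_le (hT : T.IsTree) {H : Subgroup (T ≃g T)}
    (hH : HasPropertyP T H) : pkClosure T hT 1 H ≤ H := by
  classical
  intro g hg
  let Good (F : Finset V) : Prop :=
    SpansConnected T (F : Set V) ∧ ∃ h ∈ H, ∀ x ∈ F, h x = g x
  have hleaf : ∀ F v w, Good F → v ∈ F → T.Adj v w → Good (insert w F) := by
    rintro F v w ⟨hF, h, hh, hhg⟩ hv hvw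
    constructor
    · have hmono {x y : V} (hx : x ∈ F) (hy : y ∈ F) : Relation.ReflTransGen
          (fun a b => T.Adj a b ∧ b ∈ ((insert w F : Finset V) : Set V)) x y :=
        Relation.ReflTransGen.mono (fun a b h => ⟨h.1, Finset.mem_insert_of_mem h.2⟩) _ _
          (hF x hx y hy)
      intro x hx y hy
      rcases Finset.mem_insert.1 hx with rfl | hx' <;>
        rcases Finset.mem_insert.1 hy with rfl | hy'
      · exact .refl
      · exact .head ⟨hvw.symm, Finset.mem_insert_of_mem hv⟩ (hmono hv hy')
      · exact (hmono hx' hv).tail ⟨hvw, Finset.mem_insert_self _ _⟩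
      · exact hmono hx' hy'
    · by_cases hwF : w ∈ F
      · rw [Finset.insert_eq_of_mem hwF]
        exact ⟨h, hh, hhg⟩
      -- `h⁻¹ * g` fixes `F`; the element `s` of `H` agrees with it near `v`.
      have hk : h⁻¹ * g ∈ pkClosure T hT 1 H :=
        Subgroup.mul_mem _ (le_pkClosure hT 1 H (H.inv_mem hh)) hg
      have hkF : ∀ x ∈ F, (h⁻¹ * g) x = x := by
        intro x hx
        rw [RelIso.mul_apply, ← hhg x hx, RelIso.inv_apply_self]
      let N := F.filter (T.Adj v)
      have hN {x : V} : x ∈ N ↔ x ∈ F ∧ T.Adj v x := Finset.mem_filter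
      obtain ⟨s, hs, hsF⟩ := hk v (insert v (insert w N)) (by
        intro x hx
        rcases Finset.mem_insert.1 hx with rfl | hx
        · simp
        rcases Finset.mem_insert.1 hx with rfl | hx
        · exact (SimpleGraph.dist_eq_one_iff_adj.2 hvw).le
        · exact (SimpleGraph.dist_eq_one_iff_adj.2 (hN.1 hx).2).le)
      have hsv : s v = v := by rw [← hsF v (by simp), hkF v hv]
      obtain ⟨s', hs', h1, h2⟩ := hH.exists_trivial_beyond_finset hT hs hsv N fun x hx =>
        ⟨(hN.1 hx).2, by rw [← hsF x (by simp [hx]), hkF x (hN.1 hx).1]⟩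
      refine ⟨h * s', H.mul_mem hh hs', fun x hx => ?_⟩
      suffices s' x = (h⁻¹ * g) x by
        rw [RelIso.mul_apply, this, RelIso.mul_apply, RelIso.apply_inv_self]
      rcases Finset.mem_insert.1 hx with rfl | hx
      · rw [hsF x (by simp)]
        refine h2 x fun u hu => ?_
        have hux : 0 < T.dist x u :=
          hT.connected.pos_dist_of_ne (by rintro rfl; exact hwF (hN.1 hu).1)
        have hxv : T.dist x v = 1 := SimpleGraph.dist_eq_one_iff_adj.2 hvw.symm
        rcases hT.dist_eq_dist_add_one_of_adj x (hN.1 hu).2 with h | h <;> omega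
      · rw [hkF x hx]
        by_cases hxv : v = x
        · subst hxv
          rw [h2 v fun u hu => ?_, hsv]
          rw [T.dist_self]
          exact hT.connected.pos_dist_of_ne (hN.1 hu).2.ne
        · obtain ⟨u, hvu, hu⟩ := exists_adj_dist_add_one hT.connected hxv
          refine h1 u (hN.2 ⟨?_, hvu⟩) x (by omega)
          refine mem_of_adj_of_dist_lt hT hF (x := x) hv hx hvu ?_
          rw [T.dist_comm, T.dist_comm (u := v)]
          omega
  have hgrow : ∀ F v w, Good F → v ∈ F → ∃ F', F ⊆ F' ∧ w ∈ F' ∧ Good F' := by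
    intro F v w hF hv
    obtain ⟨p⟩ := hT.connected.preconnected v w
    induction p generalizing F with
    | nil => exact ⟨F, subset_rfl, hv, hF⟩
    | cons h p ih =>
      obtain ⟨F', h1, h2, h3⟩ := ih _ (hleaf F _ _ hF hv h) (Finset.mem_insert_self _ _)
      exact ⟨F', (Finset.subset_insert _ _).trans h1, h2, h3⟩
  obtain ⟨v₀⟩ := hT.connected.nonempty
  have hall : ∀ K : Finset V, ∃ F, v₀ ∈ F ∧ K ⊆ F ∧ Good F := by
    intro K
    induction K using Finset.induction_on with
    | empty =>
      obtain ⟨h, hh, hv⟩ := hg v₀ {v₀} (by simp)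
      refine ⟨{v₀}, by simp, by simp, ?_, h, hh, fun x hx => (hv x hx).symm⟩
      simp only [Finset.coe_singleton]
      rintro x rfl y rfl
      exact .refl
    | insert x K _ ih =>
      obtain ⟨F, hv, hK, hF⟩ := ih
      obtain ⟨F', h1, h2, h3⟩ := hgrow F v₀ x hF hv
      exact ⟨F', h1 hv, Finset.insert_subset h2 (hK.trans h1), h3⟩
  let _ : TopologicalSpace (T ≃g T) := autTopology T
  refine hH.1.closure_subset ((mem_autClosure_iff _ _).2 fun K => ?_)
  obtain ⟨F, -, hK, -, h, hh, hF⟩ := hall K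
  exact ⟨h, hh, fun x hx => hF x (hK hx)⟩

end PropertyP

/-! ### Local actions as permutations of the set of all colours -/

namespace LocalActionDiagram

variable {Δ Δ' : LocalActionDiagram.{u}}

/-- The permutation `σ` of the set of all colours restricts to an element of `G(x)` on the colours
at `x`; its values at other colours are irrelevant. Since `σ` lives on a set independent of `x`,
local actions at different vertices of a tree can be composed without transport along equalities
between vertices of `Δ`. -/
def IsLocal (Δ : LocalActionDiagram.{u}) (x : Δ.Γ.V) (σ : Equiv.Perm (Σ a, Δ.X a)) : Prop :=
  ∃ τ ∈ Δ.G x, ∀ c : Δ.Colours x, σ c.1 = (τ c).1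

theorem exists_isLocal {x : Δ.Γ.V} {τ : Equiv.Perm (Δ.Colours x)} (h : τ ∈ Δ.G x) :
    ∃ σ, Δ.IsLocal x σ ∧ ∀ c : Δ.Colours x, σ c.1 = (τ c).1 := by
  classical
  have h' (c : Δ.Colours x) : Equiv.Perm.ofSubtype τ c.1 = (τ c).1 :=
    Equiv.Perm.ofSubtype_apply_coe τ c
  exact ⟨Equiv.Perm.ofSubtype τ, ⟨τ, h, h'⟩, h'⟩

theorem isLocal_one (x : Δ.Γ.V) : Δ.IsLocal x 1 := ⟨1, (Δ.G x).one_mem, fun _ => rfl⟩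

namespace IsLocal

variable {x : Δ.Γ.V} {σ ρ : Equiv.Perm (Σ a, Δ.X a)}

theorem mul (hσ : Δ.IsLocal x σ) (hρ : Δ.IsLocal x ρ) : Δ.IsLocal x (σ * ρ) := by
  obtain ⟨τ, hτ, h⟩ := hσ
  obtain ⟨τ', hτ', h'⟩ := hρ
  exact ⟨τ * τ', (Δ.G x).mul_mem hτ hτ', fun c => by
    rw [Equiv.Perm.mul_apply, h', h, Equiv.Perm.mul_apply]⟩

theorem inv (hσ : Δ.IsLocal x σ) : Δ.IsLocal x σ⁻¹ := by
  obtain ⟨τ, hτ, h⟩ := hσ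
  refine ⟨τ⁻¹, (Δ.G x).inv_mem hτ, fun c => ?_⟩
  rw [Equiv.Perm.inv_eq_iff_eq, h, Equiv.Perm.coe_inv, Equiv.apply_symm_apply]

theorem fst_eq (hσ : Δ.IsLocal x σ) {c : Σ a, Δ.X a} (hc : Δ.Γ.o c.1 = x) :
    (σ c).1 = c.1 := by
  obtain ⟨τ, hτ, h⟩ := hσ
  rw [h ⟨c, hc⟩]
  exact ((Δ.orbits_G x ⟨c, hc⟩ _).1 ⟨τ, hτ, rfl⟩).symm

theorem mem (hσ : Δ.IsLocal x σ) {τ : Equiv.Perm (Δ.Colours x)}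
    (h : ∀ c : Δ.Colours x, (τ c).1 = σ c.1) : τ ∈ Δ.G x := by
  obtain ⟨τ', hτ', h'⟩ := hσ
  have : τ = τ' := Equiv.ext fun c => Subtype.ext ((h c).trans (h' c))
  rwa [this]

end IsLocal

theorem exists_isLocal_apply_eq {x : Δ.Γ.V} {c d : Σ a, Δ.X a} (hc : Δ.Γ.o c.1 = x)
    (h : c.1 = d.1) : ∃ σ, Δ.IsLocal x σ ∧ σ c = d := by
  obtain ⟨τ, hτ, hcd⟩ := (Δ.orbits_G x ⟨c, hc⟩ ⟨d, h ▸ hc⟩).2 h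
  obtain ⟨σ, hσ, hστ⟩ := exists_isLocal hτ
  exact ⟨σ, hσ, by rw [hστ ⟨c, hc⟩, hcd]⟩

/-- The bijection between the sets of all colours induced by an isomorphism of local action
diagrams. -/
noncomputable def Iso.onColours (θ : Iso Δ Δ') : (Σ a, Δ.X a) ≃ Σ a, Δ'.X a :=
  Equiv.ofBijective (fun c => (θ.onX (Δ.Γ.o c.1) ⟨c, rfl⟩).1) (by
    have heq : ∀ v (c : Δ.Colours v), (θ.onX (Δ.Γ.o c.1.1) ⟨c.1, rfl⟩).1 = (θ.onX v c).1 := by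
      rintro _ ⟨c, rfl⟩
      rfl
    constructor
    · intro c d h
      have h1 : c.1 = d.1 := θ.onA.injective (by
        rw [← θ.map_X _ ⟨c, rfl⟩, ← θ.map_X _ ⟨d, rfl⟩]
        exact congrArg Sigma.fst h)
      have h2 := (heq _ ⟨c, rfl⟩).symm.trans (h.trans (heq _ ⟨d, congrArg Δ.Γ.o h1.symm⟩))
      exact congrArg Subtype.val ((θ.onX _).injective (Subtype.ext h2))
    · intro d
      have hd : Δ'.Γ.o d.1 = θ.onV (θ.onV.symm (Δ'.Γ.o d.1)) := by simp
      refine ⟨((θ.onX _).symm ⟨d, hd⟩).1, ?_⟩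
      change (θ.onX (Δ.Γ.o _) ⟨_, rfl⟩).1 = d
      rw [heq]
      exact congrArg Subtype.val ((θ.onX _).apply_symm_apply _))

theorem Iso.onColours_coe (θ : Iso Δ Δ') {v : Δ.Γ.V} (c : Δ.Colours v) :
    θ.onColours c.1 = (θ.onX v c).1 := by
  obtain ⟨c, rfl⟩ := c
  rfl

theorem Iso.onColours_fst (θ : Iso Δ Δ') (c : Σ a, Δ.X a) : (θ.onColours c).1 = θ.onA c.1 :=
  θ.map_X _ ⟨c, rfl⟩

theorem Iso.isLocal_conj_iff (θ : Iso Δ Δ') (x : Δ.Γ.V) (σ : Equiv.Perm (Σ a, Δ.X a)) :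
    Δ'.IsLocal (θ.onV x) ((θ.onColours.symm.trans σ).trans θ.onColours) ↔ Δ.IsLocal x σ := by
  constructor
  · rintro ⟨τ, hτ, h⟩
    refine ⟨((θ.onX x).trans τ).trans (θ.onX x).symm, ?_, fun c => ?_⟩
    · rw [θ.map_G]
      convert hτ
      ext1 c
      simp
    · apply θ.onColours.injective
      have := h (θ.onX x c)
      rw [θ.onColours_coe]
      simpa [← θ.onColours_coe] using this
  · rintro ⟨τ, hτ, h⟩
    refine ⟨_, (θ.map_G x τ).1 hτ, fun c => ?_⟩
    obtain ⟨c, rfl⟩ := (θ.onX x).surjective c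
    simp [← θ.onColours_coe, h]

end LocalActionDiagram

/-! ### Isomorphisms between trees over a local action diagram -/

namespace DeltaTree

variable {Δ : LocalActionDiagram.{u}} {V V' V'' : Type u} {T : SimpleGraph V}
  {T' : SimpleGraph V'} {T'' : SimpleGraph V''}

theorem eq_of_L_eq (S : DeltaTree Δ T) {b b' : T.Dart} (h : b.fst = b'.fst)
    (hL : S.L b = S.L b') : b = b' := by
  refine (S.L_bijOn b.fst (S.πA b) (S.map_o b)).injOn ⟨rfl, rfl⟩ ⟨h.symm, ?_⟩ hL
  rw [← S.L_fst, ← S.L_fst, hL]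

theorem exists_L_eq (S : DeltaTree Δ T) {v : V} {c : Σ a, Δ.X a} (h : Δ.Γ.o c.1 = S.πV v) :
    ∃ b : T.Dart, b.fst = v ∧ S.L b = c := by
  obtain ⟨b, ⟨hb, -⟩, hc⟩ := (S.L_bijOn v c.1 h).surjOn rfl
  exact ⟨b, hb, hc⟩

theorem o_L_fst (S : DeltaTree Δ T) (b : T.Dart) : Δ.Γ.o (S.L b).1 = S.πV b.fst := by
  rw [S.L_fst, S.map_o]

/-- An isomorphism between the trees of two `Δ`-trees that respects the projections of vertices and
whose local action at each vertex belongs to the prescribed group. It then respects the projections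
of arcs as well. -/
def IsLocalIso (S : DeltaTree Δ T) (S' : DeltaTree Δ T') (g : T ≃g T') : Prop :=
  ∀ v, S'.πV (g v) = S.πV v ∧ ∃ σ, Δ.IsLocal (S.πV v) σ ∧
    ∀ b : T.Dart, b.fst = v → S'.L (g.toHom.mapDart b) = σ (S.L b)

theorem IsLocalIso.trans {S : DeltaTree Δ T} {S' : DeltaTree Δ T'} {S'' : DeltaTree Δ T''}
    {g : T ≃g T'} {h : T' ≃g T''} (hg : S.IsLocalIso S' g) (hh : S'.IsLocalIso S'' h) :
    S.IsLocalIso S'' (g.trans h) := by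
  intro v
  obtain ⟨h1, σ, hσ, hgσ⟩ := hg v
  obtain ⟨h2, ρ, hρ, hhρ⟩ := hh (g v)
  rw [h1] at hρ h2
  refine ⟨h2, ρ * σ, hρ.mul hσ, fun b hb => ?_⟩
  rw [Equiv.Perm.mul_apply, ← hgσ b hb, ← hhρ _ (congrArg g hb)]
  rfl

theorem IsLocalIso.symm {S : DeltaTree Δ T} {S' : DeltaTree Δ T'} {g : T ≃g T'}
    (hg : S.IsLocalIso S' g) : S'.IsLocalIso S g.symm := by
  intro w
  obtain ⟨v, rfl⟩ := g.surjective w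
  obtain ⟨h1, σ, hσ, hgσ⟩ := hg v
  rw [h1, g.symm_apply_apply]
  refine ⟨rfl, σ⁻¹, hσ.inv, fun b hb => ?_⟩
  have h2 : g.toHom.mapDart (g.symm.toHom.mapDart b) = b := by
    ext1
    exact Prod.ext (g.apply_symm_apply _) (g.apply_symm_apply _)
  have h3 : g.symm b.fst = v := by rw [hb, g.symm_apply_apply]
  rw [eq_comm, Equiv.Perm.inv_eq_iff_eq, ← hgσ _ h3, h2]

theorem mem_universalGroup_iff (S : DeltaTree Δ T) (g : T ≃g T) :
    g ∈ S.universalGroup ↔ S.IsLocalIso S g := by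
  constructor
  · rintro ⟨hg, h⟩ v
    obtain ⟨σ, hσ, hσ'⟩ := LocalActionDiagram.exists_isLocal (h v)
    refine ⟨hg.1 v, σ, hσ, fun b hb => ?_⟩
    have := S.localAction_colourAt ⟨g, hg⟩ v ⟨b, hb⟩
    rw [← hσ'] at this
    exact this.symm
  · intro h
    have hg : g ∈ S.autπ := by
      refine ⟨fun v => (h v).1, fun b => ?_⟩
      obtain ⟨-, σ, hσ, h2⟩ := h b.fst
      have h3 : S.L (g • b) = σ (S.L b) := h2 b rfl
      rw [← S.L_fst, ← S.L_fst, h3, hσ.fst_eq (S.o_L_fst b)]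
    refine ⟨hg, fun v => ?_⟩
    obtain ⟨-, σ, hσ, h2⟩ := h v
    refine hσ.mem fun c => ?_
    obtain ⟨b, rfl⟩ := (S.colourAt v).surjective c
    rw [S.localAction_colourAt]
    exact h2 b.1 b.2

theorem IsLocalIso.conj_mem_iff {S : DeltaTree Δ T} {S' : DeltaTree Δ T'} {θ : T ≃g T'}
    (hθ : S.IsLocalIso S' θ) (g : T ≃g T) :
    g ∈ S.universalGroup ↔ (θ.symm.trans g).trans θ ∈ S'.universalGroup := by
  rw [mem_universalGroup_iff, mem_universalGroup_iff]
  refine ⟨fun h => (hθ.symm.trans h).trans hθ, fun h => ?_⟩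
  have : (θ.trans ((θ.symm.trans g).trans θ)).trans θ.symm = g := by
    ext1 v
    simp
  rw [← this]
  exact (hθ.trans h).trans hθ.symm

/-- Every local action prescribed at one vertex extends to an isomorphism between two given
`Δ`-trees. In particular, `Δ`-trees are unique up to isomorphism, and the universal group is
transitive on the fibres of the projection. -/
theorem exists_isLocalIso (S : DeltaTree Δ T) (S' : DeltaTree Δ T') {v : V} {w : V'}
    (hvw : S'.πV w = S.πV v) {σ : Equiv.Perm (Σ a, Δ.X a)} (hσ : Δ.IsLocal (S.πV v) σ) :
    ∃ g : T ≃g T', S.IsLocalIso S' g ∧ g v = w ∧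
      ∀ b : T.Dart, b.fst = v → S'.L (g.toHom.mapDart b) = σ (S.L b) := by
  let D (v : V) (w : V') (f : V → V') (σ : Equiv.Perm (Σ a, Δ.X a)) : Prop :=
    ∀ u (h : T.Adj v u), ∃ h' : T'.Adj w (f u), S'.L ⟨(w, f u), h'⟩ = σ (S.L ⟨(v, u), h⟩)
  have hD {v : V} {w : V'} (hvw : S'.πV w = S.πV v) {σ : Equiv.Perm (Σ a, Δ.X a)}
      (hσ : Δ.IsLocal (S.πV v) σ) : ∃ f, D v w f σ := by
    refine Classical.skolem (p := fun u u' => ∀ h : T.Adj v u, ∃ h' : T'.Adj w u',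
      S'.L ⟨(w, u'), h'⟩ = σ (S.L ⟨(v, u), h⟩)).1 fun u => ?_
    by_cases h : T.Adj v u
    · obtain ⟨⟨⟨_, u'⟩, h'⟩, rfl, hb⟩ := S'.exists_L_eq (v := w) (c := σ (S.L ⟨(v, u), h⟩))
        (by rw [hσ.fst_eq (S.o_L_fst _), S.o_L_fst, hvw])
      exact ⟨u', fun _ => ⟨h', hb⟩⟩
    · exact ⟨w, fun h' => absurd h' h⟩
  obtain ⟨f₀, hf₀⟩ := hD hvw hσ
  obtain ⟨g, hgv, hgf, hg⟩ := exists_iso_of_local S.isTree S'.isTree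
    (fun v w f => S'.πV w = S.πV v ∧ ∃ σ, Δ.IsLocal (S.πV v) σ ∧ D v w f σ) (by
      rintro v w f ⟨hvw, σ, hσ, hf⟩
      refine ⟨fun u hu => (hf u hu).1, fun u hu u' hu' huu => ?_, fun u' hu' => ?_⟩
      · obtain ⟨h1, h2⟩ := hf u hu
        obtain ⟨h1', h2'⟩ := hf u' hu'
        have h3 : S'.L ⟨(w, f u), h1⟩ = S'.L ⟨(w, f u'), h1'⟩ := by simp only [huu]
        have h4 := S.eq_of_L_eq (b := ⟨(v, u), hu⟩) (b' := ⟨(v, u'), hu'⟩) rfl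
          (σ.injective (by rw [← h2, ← h2', h3]))
        exact congrArg (fun b : T.Dart => b.snd) h4
      · obtain ⟨⟨⟨_, u⟩, hu⟩, rfl, hb⟩ := S.exists_L_eq (v := v)
          (c := σ⁻¹ (S'.L ⟨(w, u'), hu'⟩)) (by
            rw [hσ.inv.fst_eq (by rw [S'.o_L_fst, hvw]), S'.o_L_fst, hvw])
        refine ⟨u, hu, ?_⟩
        obtain ⟨h1, h2⟩ := hf u hu
        have h3 := S'.eq_of_L_eq (b := ⟨(w, f u), h1⟩) (b' := ⟨(w, u'), hu'⟩) rfl (by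
          rw [h2, hb, Equiv.Perm.coe_inv, Equiv.apply_symm_apply])
        exact congrArg (fun b : T'.Dart => b.snd) h3) (by
      rintro v w f ⟨hvw, σ, hσ, hf⟩ u hu
      obtain ⟨h1, h2⟩ := hf u hu
      have hA : S'.πA ⟨(w, f u), h1⟩ = S.πA ⟨(v, u), hu⟩ := by
        rw [← S'.L_fst, h2, hσ.fst_eq (S.o_L_fst _), S.L_fst]
      have hA' : S'.πA ⟨(f u, w), h1.symm⟩ = S.πA ⟨(u, v), hu.symm⟩ :=
        (S'.map_r ⟨(w, f u), h1⟩).symm.trans ((congrArg _ hA).trans (S.map_r _))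
      have hV : S'.πV (f u) = S.πV u :=
        (S'.map_o ⟨(f u, w), h1.symm⟩).symm.trans ((congrArg _ hA').trans (S.map_o _))
      obtain ⟨ρ, hρ, hρ'⟩ := LocalActionDiagram.exists_isLocal_apply_eq
        (S.o_L_fst ⟨(u, v), hu.symm⟩) (d := S'.L ⟨(f u, w), h1.symm⟩)
        (by rw [S.L_fst, S'.L_fst, hA'])
      obtain ⟨f', hf'⟩ := hD hV hρ
      refine ⟨f', ⟨hV, ρ, hρ, hf'⟩, ?_⟩
      obtain ⟨h3, h4⟩ := hf' v hu.symm
      have h5 := S'.eq_of_L_eq (b := ⟨(f u, f' v), h3⟩) (b' := ⟨(f u, w), h1.symm⟩) rfl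
        (by rw [h4, hρ'])
      exact congrArg (fun b : T'.Dart => b.snd) h5)
    (v₀ := v) (w₀ := w) (f₀ := f₀) ⟨hvw, σ, hσ, hf₀⟩
  have hmap {v : V} {w : V'} {f : V → V'} {σ : Equiv.Perm (Σ a, Δ.X a)} (h : D v w f σ)
      (hw : g v = w) (hf : ∀ u, T.Adj v u → g u = f u) :
      ∀ b : T.Dart, b.fst = v → S'.L (g.toHom.mapDart b) = σ (S.L b) := by
    rintro ⟨⟨v, u⟩, hu⟩ rfl
    subst hw
    obtain ⟨h1, h2⟩ := h u hu
    rw [← h2]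
    congr 1
    ext1
    exact Prod.ext rfl (hf u hu)
  refine ⟨g, fun v => ?_, hgv, hmap hf₀ hgv hgf⟩
  obtain ⟨f, ⟨h1, σ, hσ, hf⟩, h2⟩ := hg v
  exact ⟨h1, σ, hσ, hmap hf rfl h2⟩

/-- The local conditions that define the universal group only involve the action on finite subsets
of balls of radius one, as the groups `G(v)` are closed. -/
theorem pkClosure_universalGroup_le (S : DeltaTree Δ T) :
    pkClosure T S.isTree 1 S.universalGroup ≤ S.universalGroup := by
  classical
  intro g hg
  have hball (b : T.Dart) : T.dist b.fst b.snd ≤ 1 := (SimpleGraph.dist_eq_one_iff_adj.2 b.adj).le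
  have hdart {h : T ≃g T} {b : T.Dart} (h1 : g b.fst = h b.fst) (h2 : g b.snd = h b.snd) :
      g • b = h • b := by
    ext1
    exact Prod.ext h1 h2
  have hgπ : g ∈ S.autπ := by
    constructor
    · intro v
      obtain ⟨h, ⟨hh, -⟩, hF⟩ := hg v {v} (by simp)
      rw [hF v (by simp), hh.1]
    · intro b
      obtain ⟨h, ⟨hh, -⟩, hF⟩ := hg b.fst {b.fst, b.snd} (by simpa using hball b)
      rw [hdart (hF _ (by simp)) (hF _ (by simp)), hh.2]
  refine ⟨hgπ, fun v => ?_⟩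
  let _ : TopologicalSpace (Equiv.Perm (Δ.Colours (S.πV v))) := permTopology _
  refine (Δ.closed_G _).closure_subset ((mem_permClosure_iff _ _).2 fun F => ?_)
  obtain ⟨h, ⟨hh, hh'⟩, hF⟩ := hg v
    (insert v (F.image fun c => ((S.colourAt v).symm c).1.snd)) (by
      intro w hw
      rcases Finset.mem_insert.1 hw with rfl | hw
      · simp
      · obtain ⟨c, -, rfl⟩ := Finset.mem_image.1 hw
        have := hball ((S.colourAt v).symm c).1
        rwa [((S.colourAt v).symm c).2] at this)
  refine ⟨_, hh' v, fun c hc => ?_⟩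
  obtain ⟨b, rfl⟩ := (S.colourAt v).surjective c
  apply Subtype.ext
  rw [S.localAction_colourAt, S.localAction_colourAt]
  refine congrArg S.L (hdart ?_ ?_).symm
  · rw [b.2]
    exact hF v (Finset.mem_insert_self _ _)
  · refine hF _ (Finset.mem_insert_of_mem (Finset.mem_image.2 ⟨_, hc, ?_⟩))
    rw [Equiv.symm_apply_apply]

theorem hasPropertyP_universalGroup (S : DeltaTree Δ T) : HasPropertyP T S.universalGroup :=
  hasPropertyP_of_pkClosure_le S.isTree S.pkClosure_universalGroup_le

/-- A `Δ'`-tree as a `Δ`-tree, for isomorphic diagrams `Δ` and `Δ'`. -/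
noncomputable def ofIso {Δ' : LocalActionDiagram.{u}} (S : DeltaTree Δ' T)
    (θ : LocalActionDiagram.Iso Δ Δ') : DeltaTree Δ T where
  isTree := S.isTree
  πV v := θ.onV.symm (S.πV v)
  πA b := θ.onA.symm (S.πA b)
  map_o b := by rw [Equiv.eq_symm_apply, ← θ.map_o, Equiv.apply_symm_apply, S.map_o]
  map_r b := by rw [Equiv.eq_symm_apply, ← θ.map_r, Equiv.apply_symm_apply, S.map_r]
  πV_surjective := θ.onV.symm.surjective.comp S.πV_surjective
  πA_surjective := θ.onA.symm.surjective.comp S.πA_surjective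
  L b := θ.onColours.symm (S.L b)
  L_bijOn v a ha := by
    rw [Equiv.eq_symm_apply, ← θ.map_o] at ha
    have h1 : Set.BijOn θ.onColours.symm {c : Σ a, Δ'.X a | c.1 = θ.onA a}
        {c : Σ a, Δ.X a | c.1 = a} := by
      refine θ.onColours.symm.bijOn fun c => ?_
      obtain ⟨c, rfl⟩ := θ.onColours.surjective c
      simp [θ.onColours_fst]
    simpa only [Equiv.symm_apply_eq, Function.comp_def] using h1.comp (S.L_bijOn v (θ.onA a) ha)

theorem universalGroup_ofIso {Δ' : LocalActionDiagram.{u}} (S : DeltaTree Δ' T)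
    (θ : LocalActionDiagram.Iso Δ Δ') : (S.ofIso θ).universalGroup = S.universalGroup := by
  ext g
  rw [mem_universalGroup_iff, mem_universalGroup_iff]
  refine forall_congr' fun v => and_congr θ.onV.symm.injective.eq_iff ?_
  have hv : θ.onV ((S.ofIso θ).πV v) = S.πV v := θ.onV.apply_symm_apply _
  constructor
  · rintro ⟨σ, hσ, h⟩
    rw [← θ.isLocal_conj_iff, hv] at hσ
    refine ⟨_, hσ, fun b hb => ?_⟩
    have h1 : θ.onColours.symm (S.L (g.toHom.mapDart b)) = σ (θ.onColours.symm (S.L b)) := h b hb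
    simp [← h1]
  · rintro ⟨σ, hσ, h⟩
    refine ⟨(θ.onColours.trans σ).trans θ.onColours.symm, ?_, fun b hb => ?_⟩
    · rw [← θ.isLocal_conj_iff, hv]
      convert hσ
      ext1 c
      simp
    · change θ.onColours.symm (S.L (g.toHom.mapDart b)) =
        ((θ.onColours.trans σ).trans θ.onColours.symm) (θ.onColours.symm (S.L b))
      simpa using h b hb

/-- The structure of a `Δ`-tree carried over along an isomorphism of trees. -/
noncomputable def map (S : DeltaTree Δ T) (θ : T ≃g T') : DeltaTree Δ T' where
  isTree := θ.isTree_iff.1 S.isTree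
  πV v := S.πV (θ.symm v)
  πA b := S.πA (θ.symm.toHom.mapDart b)
  map_o _ := S.map_o _
  map_r _ := S.map_r _
  πV_surjective := S.πV_surjective.comp θ.symm.surjective
  πA_surjective a := by
    obtain ⟨b, rfl⟩ := S.πA_surjective a
    refine ⟨θ.toHom.mapDart b, congrArg S.πA ?_⟩
    ext1
    exact Prod.ext (θ.symm_apply_apply _) (θ.symm_apply_apply _)
  L b := S.L (θ.symm.toHom.mapDart b)
  L_bijOn v a ha := by
    refine (S.L_bijOn (θ.symm v) a ha).comp ⟨?_, ?_, ?_⟩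
    · rintro b ⟨rfl, hb⟩
      exact ⟨rfl, hb⟩
    · intro b _ b' _ h
      have h1 : θ.symm b.fst = θ.symm b'.fst := congrArg (fun b : T.Dart => b.fst) h
      have h2 : θ.symm b.snd = θ.symm b'.snd := congrArg (fun b : T.Dart => b.snd) h
      ext1
      exact Prod.ext (θ.symm.injective h1) (θ.symm.injective h2)
    · rintro b ⟨hb, hba⟩
      have h : θ.symm.toHom.mapDart (θ.toHom.mapDart b) = b := by
        ext1
        exact Prod.ext (θ.symm_apply_apply _) (θ.symm_apply_apply _)
      refine ⟨θ.toHom.mapDart b, ⟨?_, (congrArg S.πA h).trans hba⟩, h⟩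
      exact (congrArg θ hb).trans (θ.apply_symm_apply v)

theorem isLocalIso_map (S : DeltaTree Δ T) (θ : T ≃g T') : S.IsLocalIso (S.map θ) θ := by
  refine fun v => ⟨congrArg S.πV (θ.symm_apply_apply v), 1, LocalActionDiagram.isLocal_one _,
    fun b _ => congrArg S.L ?_⟩
  ext1
  exact Prod.ext (θ.symm_apply_apply _) (θ.symm_apply_apply _)

end DeltaTree

/-! ### Construction of a tree over a local action diagram -/

/-- A graph is a tree if it arises from a parent function `p`, with root `r` and depth `d`, by
joining each vertex other than the root to its parent. -/
theorem isTree_of_parent {V : Type*} {T : SimpleGraph V} (r : V) (p : V → V) (d : V → ℕ)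
    (hd : ∀ v, v ≠ r → d v = d (p v) + 1)
    (hT : ∀ v w, T.Adj v w ↔ (v ≠ r ∧ p v = w) ∨ (w ≠ r ∧ p w = v)) : T.IsTree := by
  have hreach : ∀ n v, d v = n → T.Reachable v r := by
    intro n
    induction n with
    | zero =>
      intro v hv
      by_cases h : v = r
      · rw [h]
      · have := hd v h
        omega
    | succ n ih =>
      intro v hv
      by_cases h : v = r
      · rw [h]
      · have hvp : T.Adj v (p v) := (hT _ _).2 (.inl ⟨h, rfl⟩)
        exact hvp.reachable.trans (ih _ (by have := hd v h; omega))
  have : Nonempty V := ⟨r⟩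
  refine ⟨⟨fun v w => (hreach _ v rfl).trans (hreach _ w rfl).symm⟩, ?_⟩
  -- The edge from `v` to `p v` is a bridge: when it is removed, no path leaves the set of
  -- descendants of `v`.
  have hbridge : ∀ v, v ≠ r → ¬ (T \ SimpleGraph.fromEdgeSet {s(v, p v)}).Reachable v (p v) := by
    rintro v hv ⟨q⟩
    let D (w : V) : Prop :=
      Relation.ReflTransGen (fun a b => a ≠ r ∧ p a = b ∧ d a = d b + 1) w v
    have hD : ∀ w, D w → d v ≤ d w := by
      intro w h
      induction h using Relation.ReflTransGen.head_induction_on with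
      | refl => exact le_rfl
      | head h _ ih => omega
    have hclosed : ∀ a b, (T \ SimpleGraph.fromEdgeSet {s(v, p v)}).Walk a b → D a → D b := by
      intro a b q
      induction q with
      | nil => exact id
      | @cons a b c h q ih =>
        refine fun ha => ih ?_
        rw [SimpleGraph.sdiff_adj, hT] at h
        obtain ⟨⟨har, rfl⟩ | ⟨hbr, rfl⟩, h⟩ := h
        · rcases ha.cases_head with rfl | ⟨c, ⟨-, rfl, -⟩, hc⟩
          · refine absurd ?_ h
            have hne : a ≠ p a := fun he => by
              have := hd a har
              rw [← he] at this
              omega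
            simp [hne]
          · exact hc
        · exact .head ⟨hbr, rfl, hd b hbr⟩ ha
    have := hD _ (hclosed _ _ q .refl)
    have := hd v hv
    omega
  rw [SimpleGraph.isAcyclic_iff_forall_adj_isBridge]
  intro v w hvw
  rw [SimpleGraph.isBridge_iff]
  rcases (hT v w).1 hvw with ⟨hv, rfl⟩ | ⟨hw, rfl⟩
  · exact hbridge v hv
  · rw [SimpleGraph.reachable_comm, Sym2.eq_swap]
    exact hbridge w hw

namespace LocalActionDiagram

variable (Δ : LocalActionDiagram.{u}) (x₀ : Δ.Γ.V) (ρ : ∀ a, Δ.X a)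

/-- The end vertex of a coloured path in `Δ` that starts at `x₀`. Paths are lists of colours, the
last step coming first. -/
def endVertex : List (Σ a, Δ.X a) → Δ.Γ.V
  | [] => x₀
  | c :: _ => Δ.Γ.t c.1

/-- The colour of the step back at the end of a coloured path: for every arc `a`, the fixed colour
`ρ (r a)` is that of the step back after a step along `a`. -/
def backColour : List (Σ a, Δ.X a) → Option (Σ a, Δ.X a)
  | [] => none
  | c :: _ => some ⟨Δ.Γ.r c.1, ρ _⟩

/-- The list of colours is a path in `Δ` from `x₀` without steps back. -/
def IsReducedPath : List (Σ a, Δ.X a) → Prop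
  | [] => True
  | c :: l => Δ.Γ.o c.1 = Δ.endVertex x₀ l ∧ Δ.backColour ρ l ≠ some c ∧ IsReducedPath l

/-- The vertices of the tree over `Δ`: the coloured paths from `x₀` without steps back. -/
abbrev PathVertex : Type u := {l : List (Σ a, Δ.X a) // Δ.IsReducedPath x₀ ρ l}

variable {Δ x₀ ρ}

/-- The step of colour `c` leads from `v` to `w`: either it extends the path `v`, or it is the
step back. -/
def PathVertex.Step (v w : Δ.PathVertex x₀ ρ) (c : Σ a, Δ.X a) : Prop :=
  w.1 = c :: v.1 ∨ (Δ.backColour ρ v.1 = some c ∧ w.1 = v.1.tail)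

namespace PathVertex

variable {v w w' : Δ.PathVertex x₀ ρ} {c c' : Σ a, Δ.X a}

theorem Step.reverse (h : v.Step w c) : ∃ d, d.1 = Δ.Γ.r c.1 ∧ w.Step v d := by
  obtain ⟨v, hv⟩ := v
  obtain ⟨w, hw⟩ := w
  rcases h with h | ⟨h, h'⟩
  · simp only at h
    subst h
    exact ⟨_, rfl, .inr ⟨rfl, rfl⟩⟩
  · cases v with
    | nil => cases h
    | cons d l =>
      obtain rfl : w = l := h'
      obtain rfl : (⟨Δ.Γ.r d.1, ρ _⟩ : Σ a, Δ.X a) = c := Option.some.inj h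
      exact ⟨d, (Δ.Γ.r_r _).symm, .inl rfl⟩

theorem Step.o_eq (h : v.Step w c) : Δ.Γ.o c.1 = Δ.endVertex x₀ v.1 := by
  obtain ⟨v, hv⟩ := v
  obtain ⟨w, hw⟩ := w
  rcases h with h | ⟨h, -⟩
  · simp only at h
    subst h
    exact hw.1
  · cases v with
    | nil => cases h
    | cons d l =>
      obtain rfl : (⟨Δ.Γ.r d.1, ρ _⟩ : Σ a, Δ.X a) = c := Option.some.inj h
      rfl

theorem Step.t_eq (h : v.Step w c) : Δ.Γ.t c.1 = Δ.endVertex x₀ w.1 := by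
  obtain ⟨d, hd, h'⟩ := h.reverse
  rw [← h'.o_eq, hd]
  rfl

theorem Step.right_unique (h : v.Step w c) (h' : v.Step w' c) : w = w' := by
  have key {w w' : Δ.PathVertex x₀ ρ} (h1 : w.1 = c :: v.1) (h2 : Δ.backColour ρ v.1 = some c) :
      False := by
    have := w.2
    rw [h1] at this
    exact this.2.1 h2
  rcases h with h | ⟨h1, h2⟩ <;> rcases h' with h' | ⟨h1', h2'⟩
  · exact Subtype.ext (h.trans h'.symm)
  · exact (key (w' := w) h h1').elim
  · exact (key (w' := w) h' h1).elim
  · exact Subtype.ext (h2.trans h2'.symm)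

theorem Step.colour_unique (h : v.Step w c) (h' : v.Step w c') : c = c' := by
  have key {c c' : Σ a, Δ.X a} (h1 : w.1 = c :: v.1) (h2 : w.1 = v.1.tail) : False := by
    have := congrArg List.length (h1.symm.trans h2)
    simp at this
    omega
  rcases h with h | ⟨h1, h2⟩ <;> rcases h' with h' | ⟨h1', h2'⟩
  · exact (List.cons.inj (h.symm.trans h')).1
  · exact (key (c' := c) h h2').elim
  · exact (key (c' := c) h' h2).elim
  · exact Option.some.inj (h1.symm.trans h1')

theorem exists_step (h : Δ.Γ.o c.1 = Δ.endVertex x₀ v.1) : ∃ w, v.Step w c := by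
  by_cases hb : Δ.backColour ρ v.1 = some c
  · obtain ⟨v, hv⟩ := v
    cases v with
    | nil => cases hb
    | cons d l => exact ⟨⟨l, hv.2.2⟩, .inr ⟨hb, rfl⟩⟩
  · exact ⟨⟨c :: v.1, h, hb, v.2⟩, .inl rfl⟩

variable (Δ x₀ ρ)

/-- The tree over `Δ`: two coloured paths are adjacent if a step leads from one to the other. -/
def tree : SimpleGraph (Δ.PathVertex x₀ ρ) where
  Adj v w := ∃ c, v.Step w c
  symm := ⟨fun v w ⟨_, h⟩ => let ⟨d, _, h'⟩ := h.reverse; ⟨d, h'⟩⟩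
  loopless := ⟨by
    rintro v ⟨c, h⟩
    rcases h with h | ⟨h, h'⟩
    · simp at h
    · obtain ⟨_ | ⟨d, l⟩, hv⟩ := v
      · cases h
      · simp at h'⟩

theorem isTree_tree : (tree Δ x₀ ρ).IsTree := by
  have htail : ∀ l, Δ.IsReducedPath x₀ ρ l → Δ.IsReducedPath x₀ ρ l.tail := by
    rintro (_ | ⟨c, l⟩) h
    exacts [h, h.2.2]
  have hroot {v : Δ.PathVertex x₀ ρ} : v ≠ ⟨[], trivial⟩ ↔ v.1 ≠ [] := not_congr Subtype.ext_iff
  have hback {v w : Δ.PathVertex x₀ ρ} (h : v.1 ≠ []) (hw : v.1.tail = w.1) : ∃ c, v.Step w c := by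
    obtain ⟨_ | ⟨d, l⟩, hv⟩ := v
    · exact absurd rfl h
    · exact ⟨_, .inr ⟨rfl, hw.symm⟩⟩
  refine isTree_of_parent ⟨[], trivial⟩ (fun v => ⟨v.1.tail, htail v.1 v.2⟩)
    (fun v => v.1.length) (fun v hv => ?_) fun v w => ?_
  · rw [hroot] at hv
    have := List.length_pos_iff.2 hv
    simp only [List.length_tail]
    omega
  · rw [hroot, hroot, Subtype.ext_iff, Subtype.ext_iff]
    constructor
    · rintro ⟨c, h | ⟨h, h'⟩⟩
      · exact .inr (by simp [h])
      · refine .inl ⟨fun h0 => ?_, h'.symm⟩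
        rw [h0] at h
        cases h
    · rintro (⟨h, h'⟩ | ⟨h, h'⟩)
      · exact hback h h'
      · obtain ⟨c, hc⟩ := hback h h'
        obtain ⟨d, -, hd⟩ := hc.reverse
        exact ⟨d, hd⟩

theorem exists_endVertex_eq (y : Δ.Γ.V) : ∃ v : Δ.PathVertex x₀ ρ, Δ.endVertex x₀ v.1 = y := by
  induction Δ.connected.2 x₀ y with
  | refl => exact ⟨⟨[], trivial⟩, rfl⟩
  | tail _ h ih =>
    obtain ⟨a, ha, rfl⟩ := h
    obtain ⟨v, hv⟩ := ih
    obtain ⟨w, hw⟩ := exists_step (v := v) (c := ⟨a, ρ a⟩) (ha.trans hv.symm)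
    exact ⟨w, hw.t_eq.symm⟩

end PathVertex

/-- Every local action diagram has a tree over it. -/
theorem exists_deltaTree (Δ : LocalActionDiagram.{u}) :
    ∃ (V : Type u) (T : SimpleGraph V), Nonempty (DeltaTree Δ T) := by
  obtain ⟨x₀⟩ := Δ.connected.1
  let ρ : ∀ a, Δ.X a := fun a => (Δ.nonempty_X a).some
  refine ⟨Δ.PathVertex x₀ ρ, PathVertex.tree Δ x₀ ρ, ?_⟩
  have hstep : ∀ b : (PathVertex.tree Δ x₀ ρ).Dart, ∃ c, b.fst.Step b.snd c := fun b => b.adj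
  choose L hL using hstep
  have hLa {v : Δ.PathVertex x₀ ρ} {c : Σ a, Δ.X a} (hc : Δ.Γ.o c.1 = Δ.endVertex x₀ v.1) :
      ∃ b : (PathVertex.tree Δ x₀ ρ).Dart, b.fst = v ∧ L b = c := by
    obtain ⟨w, hw⟩ := PathVertex.exists_step hc
    exact ⟨⟨(v, w), c, hw⟩, rfl, (hL _).colour_unique hw⟩
  refine ⟨
    { isTree := PathVertex.isTree_tree Δ x₀ ρ
      πV := fun v => Δ.endVertex x₀ v.1
      πA := fun b => (L b).1
      map_o := fun b => (hL b).o_eq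
      map_r := fun b => ?_
      πV_surjective := PathVertex.exists_endVertex_eq Δ x₀ ρ
      πA_surjective := fun a => ?_
      L := L
      L_bijOn := fun v a ha => ⟨fun b hb => hb.2, ?_, ?_⟩ }⟩
  · obtain ⟨d, hd, h⟩ := (hL b).reverse
    rw [← hd, (hL b.symm).colour_unique h]
  · obtain ⟨v, hv⟩ := PathVertex.exists_endVertex_eq Δ x₀ ρ (Δ.Γ.o a)
    obtain ⟨b, -, hb⟩ := hLa (v := v) (c := ⟨a, ρ a⟩) hv.symm
    exact ⟨b, congrArg Sigma.fst hb⟩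
  · rintro b ⟨rfl, -⟩ b' ⟨hb, -⟩ h
    have h1 := hL b'
    rw [hb, ← h] at h1
    ext1
    exact Prod.ext hb.symm ((hL b).right_unique h1)
  · rintro c rfl
    obtain ⟨b, hb, hbc⟩ := hLa ha
    exact ⟨b, ⟨hb, congrArg Sigma.fst hbc⟩, hbc⟩

end LocalActionDiagram

/-! ### Associated local action diagrams -/

namespace AssociatedChoice

section Closure

variable {V : Type u} {T : SimpleGraph V} {G : Subgroup (T ≃g T)} (κ : AssociatedChoice T G)

theorem le_universalGroup (hT : T.IsTree) : G ≤ (κ.deltaTree hT).universalGroup := by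
  intro g hg
  rw [DeltaTree.mem_universalGroup_iff]
  intro v
  have hq : quotV T G (g v) = quotV T G v := (quotV_eq_iff T G _ _).2 ⟨g, hg, rfl⟩
  refine ⟨hq, ?_⟩
  -- The local action of `g` at `v` is induced by the following element of `G`, which fixes the
  -- representative of the orbit of `v`.
  let a := κ.toStar (g v) * g * (κ.toStar v)⁻¹
  have ha : a ∈ G :=
    G.mul_mem (G.mul_mem (κ.toStar_mem _) hg) (G.inv_mem (κ.toStar_mem _))
  have hav : a (κ.star (quotV T G v)) = κ.star (quotV T G v) := by
    rw [← κ.toStar_apply v, RelIso.mul_apply, RelIso.inv_apply_self, RelIso.mul_apply,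
      κ.toStar_apply, hq, κ.toStar_apply]
  have hτ : κ.stabPerm (quotV T G v) a ha hav ∈ (κ.diagram hT).G (quotV T G v) :=
    (mem_permClosure_iff _ _).2 fun _ => ⟨_, ⟨a, ha, hav, fun _ => rfl⟩, fun _ _ => rfl⟩
  obtain ⟨σ, hσ, hστ⟩ := LocalActionDiagram.exists_isLocal hτ
  refine ⟨σ, hσ, fun b hb => ?_⟩
  have hL : ∀ b, (κ.diagram hT).Γ.o ((κ.deltaTree hT).L b).1 = quotV T G b.fst :=
    (κ.deltaTree hT).o_L_fst
  have h1 := hστ ⟨(κ.deltaTree hT).L b, (hL b).trans (congrArg _ hb)⟩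
  refine Eq.trans ?_ h1.symm
  subst hb
  refine congrArg Subtype.val (κ.colour_ext (c := ⟨(κ.deltaTree hT).L (g • b),
    (hL _).trans hq⟩) (d := κ.stabPerm _ a ha hav ⟨(κ.deltaTree hT).L b, hL b⟩) ?_)
  change κ.toStar (g b.fst) • g • b = a • κ.toStar b.fst • b
  simp only [a, mul_smul, inv_smul_smul]

/-- An element of the universal group has local actions in the closures of groups induced by
stabilizers in `G`, so near a vertex it agrees on finite sets with elements of `G`. -/
theorem universalGroup_le_pkClosure (hT : T.IsTree) :
    (κ.deltaTree hT).universalGroup ≤ pkClosure T hT 1 G := by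
  classical
  intro g hg v F hF
  obtain ⟨hq, σ, ⟨τ, hτ, hστ⟩, hgσ⟩ := ((κ.deltaTree hT).mem_universalGroup_iff g).1 hg v
  have hq : quotV T G (g v) = quotV T G v := hq
  let col (u : {u // T.Adj v u}) : (quotientGraph T G).ColoursAt κ.X (quotV T G v) :=
    ⟨(κ.deltaTree hT).L ⟨(v, u), u.2⟩, (κ.deltaTree hT).o_L_fst _⟩
  obtain ⟨ρ, ⟨h, hh, hhv, hhρ⟩, hρ⟩ :=
    (mem_permClosure_iff _ _).1 hτ ((F.subtype (T.Adj v)).image col)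
  refine ⟨(κ.toStar (g v))⁻¹ * h * κ.toStar v,
    G.mul_mem (G.mul_mem (G.inv_mem (κ.toStar_mem _)) hh) (κ.toStar_mem _), fun u hu => ?_⟩
  apply (κ.toStar (g v)).injective
  rw [RelIso.mul_apply, RelIso.mul_apply, RelIso.apply_inv_self]
  rcases Nat.le_one_iff_eq_zero_or_eq_one.1 (hF u hu) with h0 | h1
  · obtain rfl := hT.connected.dist_eq_zero_iff.1 h0
    rw [κ.toStar_apply, κ.toStar_apply, hq]
    exact hhv.symm
  · have hvu : T.Adj v u := SimpleGraph.dist_eq_one_iff_adj.1 h1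
    have h2 : (κ.deltaTree hT).L (g • ⟨(v, u), hvu⟩) = (ρ (col ⟨u, hvu⟩)).1 := by
      rw [hρ (col ⟨u, hvu⟩) (Finset.mem_image_of_mem _ (Finset.mem_subtype.2 hu))]
      exact (hgσ ⟨(v, u), hvu⟩ rfl).trans (hστ (col ⟨u, hvu⟩))
    have h3 : κ.toStar (g v) • g • (⟨(v, u), hvu⟩ : T.Dart) =
        h • κ.toStar v • (⟨(v, u), hvu⟩ : T.Dart) := by
      rw [show h • κ.toStar v • (⟨(v, u), hvu⟩ : T.Dart) = _ from (hhρ (col ⟨u, hvu⟩)).symm]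
      exact congrArg (fun c : Σ a, κ.X a => c.2.1) h2
    exact congrArg (fun b : T.Dart => b.snd) h3

theorem universalGroup_eq_pkClosure (hT : T.IsTree) :
    (κ.deltaTree hT).universalGroup = pkClosure T hT 1 G :=
  le_antisymm (κ.universalGroup_le_pkClosure hT)
    ((pkClosure_mono hT 1 (κ.le_universalGroup hT)).trans
      (κ.deltaTree hT).pkClosure_universalGroup_le)

/-- A `P`-closed group is the universal group of each of its associated local action diagrams. -/
theorem universalGroup_eq_self (hT : T.IsTree) (hG : HasPropertyP T G) :
    (κ.deltaTree hT).universalGroup = G :=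
  (κ.universalGroup_eq_pkClosure hT).trans
    (le_antisymm (hG.pkClosure_le hT) (le_pkClosure hT 1 G))

/-- The colours at a vertex of the quotient graph are the arcs of the tree that originate at its
representative. -/
def coloursEquiv (x : (quotientGraph T G).V) :
    (quotientGraph T G).ColoursAt κ.X x ≃ {b : T.Dart // b.fst = κ.star x} where
  toFun c := ⟨c.1.2.1, c.1.2.2.1.trans (congrArg κ.star c.2)⟩
  invFun b :=
    have hb : (quotientGraph T G).o (quotA T G b.1) = x := by
      rw [quot_o, b.2, κ.quotV_star]
    ⟨⟨quotA T G b.1, b.1, b.2.trans (congrArg κ.star hb.symm), rfl⟩, hb⟩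
  left_inv _ := κ.colour_ext rfl
  right_inv _ := rfl

end Closure

end AssociatedChoice

namespace DeltaTree

variable {Δ : LocalActionDiagram.{u}} {V : Type u} {T : SimpleGraph V} (S : DeltaTree Δ T)

/-- The orbits of the universal group on vertices are the fibres of the projection. -/
theorem quotV_universalGroup_eq_iff (v w : V) :
    quotV T S.universalGroup v = quotV T S.universalGroup w ↔ S.πV v = S.πV w := by
  rw [quotV_eq_iff]
  constructor
  · rintro ⟨g, hg, rfl⟩
    exact hg.1.1 w
  · intro h
    obtain ⟨g, hg, hgw, -⟩ := S.exists_isLocalIso S h (LocalActionDiagram.isLocal_one _)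
    exact ⟨g, (S.mem_universalGroup_iff g).2 hg, hgw⟩

/-- The orbits of the universal group on arcs are the fibres of the projection. -/
theorem quotA_universalGroup_eq_iff (b c : T.Dart) :
    quotA T S.universalGroup b = quotA T S.universalGroup c ↔ S.πA b = S.πA c := by
  rw [quotA_eq_iff]
  constructor
  · rintro ⟨g, hg, rfl⟩
    exact hg.1.2 c
  · intro h
    obtain ⟨σ, hσ, hcb⟩ := LocalActionDiagram.exists_isLocal_apply_eq (S.o_L_fst c)
      (d := S.L b) (by rw [S.L_fst, S.L_fst, h])
    have hV : S.πV b.fst = S.πV c.fst := by rw [← S.map_o, ← S.map_o, h]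
    obtain ⟨g, hg, hgc, hgσ⟩ := S.exists_isLocalIso S hV hσ
    refine ⟨g, (S.mem_universalGroup_iff g).2 hg, S.eq_of_L_eq hgc ?_⟩
    rw [← hcb]
    exact hgσ c rfl

/-- The stabilizer of a vertex in the universal group induces the whole prescribed local action:
every local action extends to an element of the universal group. -/
theorem mem_inducedGroup_closure_iff (κ : AssociatedChoice T S.universalGroup)
    (x : (quotientGraph T S.universalGroup).V)
    (σ : Equiv.Perm ((quotientGraph T S.universalGroup).ColoursAt κ.X x)) :
    σ ∈ permClosure (κ.inducedGroup x) ↔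
      ((((κ.coloursEquiv x).trans (S.colourAt (κ.star x))).symm.trans σ).trans
        ((κ.coloursEquiv x).trans (S.colourAt (κ.star x)))) ∈ Δ.G (S.πV (κ.star x)) := by
  classical
  have hval (c) : ((κ.coloursEquiv x).trans (S.colourAt (κ.star x)) c).1 = S.L c.1.2.1 := rfl
  generalize (κ.coloursEquiv x).trans (S.colourAt (κ.star x)) = e at hval ⊢
  have hfst (c : (quotientGraph T S.universalGroup).ColoursAt κ.X x) :
      c.1.2.1.fst = κ.star x := (κ.coloursEquiv x c).2
  constructor
  · intro hσ
    let _ : TopologicalSpace (Equiv.Perm (Δ.Colours (S.πV (κ.star x)))) := permTopology _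
    refine (Δ.closed_G _).closure_subset ((mem_permClosure_iff _ _).2 fun F => ?_)
    obtain ⟨τ, ⟨g, hg, -, hgτ⟩, hF⟩ := (mem_permClosure_iff _ _).1 hσ (F.image e.symm)
    obtain ⟨-, ρ, hρ, hgρ⟩ := (S.mem_universalGroup_iff g).1 hg (κ.star x)
    refine ⟨(e.symm.trans τ).trans e, hρ.mem fun c => ?_, fun c hc => ?_⟩
    · obtain ⟨c, rfl⟩ := e.surjective c
      rw [Equiv.trans_apply, Equiv.trans_apply, Equiv.symm_apply_apply, hval, hval, hgτ]
      exact hgρ _ (hfst c)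
    · rw [Equiv.trans_apply, Equiv.trans_apply, hF _ (Finset.mem_image_of_mem _ hc)]
      rfl
  · intro hσ
    obtain ⟨ρ, hρ, hσρ⟩ := LocalActionDiagram.exists_isLocal hσ
    obtain ⟨g, hg, hgx, hgρ⟩ := S.exists_isLocalIso S (w := κ.star x) rfl hρ
    refine (mem_permClosure_iff _ _).2 fun _ => ⟨σ, ⟨g, (S.mem_universalGroup_iff g).2 hg, hgx,
      fun c => ?_⟩, fun _ _ => rfl⟩
    refine S.eq_of_L_eq ?_ ?_
    · rw [hfst, smul_fst, hfst, hgx]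
    · refine Eq.trans ?_ (hgρ _ (hfst c)).symm
      rw [← hval, ← hval, hσρ, Equiv.trans_apply, Equiv.trans_apply, Equiv.symm_apply_apply]

/-- The local action diagram associated to a universal group, acting on a `Δ`-tree, is
isomorphic to `Δ`. -/
theorem nonempty_iso_diagram (κ : AssociatedChoice T S.universalGroup) :
    Nonempty (LocalActionDiagram.Iso (κ.diagram S.isTree) Δ) := by
  have hstar (v : V) : S.πV (κ.star (quotV T S.universalGroup v)) = S.πV v := by
    rw [← S.quotV_universalGroup_eq_iff, κ.quotV_star]
  obtain ⟨lift, hlift⟩ := (quotA_surjective T S.universalGroup).hasRightInverse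
  have hlift' (b : T.Dart) : S.πA (lift (quotA T S.universalGroup b)) = S.πA b := by
    rw [← S.quotA_universalGroup_eq_iff, hlift]
  have hV : Function.Bijective fun x : (quotientGraph T S.universalGroup).V =>
      S.πV (κ.star x) := by
    constructor
    · intro x y h
      have := (S.quotV_universalGroup_eq_iff _ _).2 h
      rwa [κ.quotV_star, κ.quotV_star] at this
    · intro x
      obtain ⟨v, rfl⟩ := S.πV_surjective x
      exact ⟨_, hstar v⟩
  have hA : Function.Bijective fun a : (quotientGraph T S.universalGroup).A =>
      S.πA (lift a) := by
    constructor
    · intro a b h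
      have := (S.quotA_universalGroup_eq_iff _ _).2 h
      rwa [hlift, hlift] at this
    · intro a
      obtain ⟨b, rfl⟩ := S.πA_surjective a
      exact ⟨_, hlift' b⟩
  exact ⟨
    { onV := Equiv.ofBijective _ hV
      onA := Equiv.ofBijective _ hA
      map_o := fun a => by
        obtain ⟨b, rfl⟩ := quotA_surjective T S.universalGroup a
        change Δ.Γ.o (S.πA (lift (quotA T _ b))) = S.πV (κ.star (quotV T _ b.fst))
        rw [hlift', hstar, S.map_o]
      map_r := fun a => by
        obtain ⟨b, rfl⟩ := quotA_surjective T S.universalGroup a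
        change Δ.Γ.r (S.πA (lift (quotA T _ b))) = S.πA (lift (quotA T _ b.symm))
        rw [hlift', hlift', S.map_r]
      onX := fun x => (κ.coloursEquiv x).trans (S.colourAt (κ.star x))
      map_X := fun x c => by
        change (S.L c.1.2.1).1 = S.πA (lift c.1.1)
        rw [S.L_fst, ← hlift', c.1.2.2.2]
      map_G := fun x σ => S.mem_inducedGroup_closure_iff κ x σ }⟩

end DeltaTree

/-! ### The correspondence -/

/-- Isomorphic local action diagrams have conjugate universal groups. -/
theorem exists_conj_of_iso {Δ Δ' : LocalActionDiagram.{u}} (e : LocalActionDiagram.Iso Δ Δ')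
    {V V' : Type u} {T : SimpleGraph V} {T' : SimpleGraph V'} (S : DeltaTree Δ T)
    (S' : DeltaTree Δ' T') : ∃ θ : T ≃g T', ∀ g : T ≃g T,
      g ∈ S.universalGroup ↔ (θ.symm.trans g).trans θ ∈ S'.universalGroup := by
  obtain ⟨v⟩ := S.isTree.connected.nonempty
  obtain ⟨w, hw⟩ := (S'.ofIso e).πV_surjective (S.πV v)
  obtain ⟨θ, hθ, -⟩ := S.exists_isLocalIso (S'.ofIso e) hw (LocalActionDiagram.isLocal_one _)
  refine ⟨θ, fun g => ?_⟩
  rw [← S'.universalGroup_ofIso e]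
  exact hθ.conj_mem_iff g

/-- Local action diagrams with conjugate universal groups are isomorphic: both are isomorphic to
the diagram associated to the group. -/
theorem equiv_of_conj {Δ Δ' : LocalActionDiagram.{u}} {V V' : Type u} {T : SimpleGraph V}
    {T' : SimpleGraph V'} (S : DeltaTree Δ T) (S' : DeltaTree Δ' T') (θ : T ≃g T')
    (hθ : ∀ g : T ≃g T,
      g ∈ S.universalGroup ↔ (θ.symm.trans g).trans θ ∈ S'.universalGroup) : Δ ≈ Δ' := by
  have h : (S.map θ).universalGroup = S'.universalGroup := by
    ext g
    have h1 : (θ.symm.trans ((θ.trans g).trans θ.symm)).trans θ = g := by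
      ext1 v
      simp
    rw [← h1, ← hθ, (S.isLocalIso_map θ).conj_mem_iff]
  have key : ∀ H : Subgroup (T' ≃g T'), (S.map θ).universalGroup = H →
      S'.universalGroup = H → Δ ≈ Δ' := by
    rintro _ rfl h'
    obtain ⟨κ⟩ : Nonempty (AssociatedChoice T' (S.map θ).universalGroup) := inferInstance
    have h1 : κ.diagram S'.isTree ≈ Δ := (S.map θ).nonempty_iso_diagram κ
    have h2 : κ.diagram S'.isTree ≈ Δ' := by
      revert κ
      rw [← h']
      exact fun κ _ => S'.nonempty_iso_diagram κ
    exact Setoid.trans (Setoid.symm h1) h2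
  exact key _ h rfl

end LocalActionTree

theorem theorem1p1 :
    -- Every local action diagram has a tree over it.
    (∀ Δ : LocalActionDiagram.{u}, ∃ (V : Type u) (T : SimpleGraph V), Nonempty (DeltaTree Δ T)) ∧
    -- The universal groups of trees over local action diagrams are `P`-closed.
    (∃ hU : ∀ (Δ : LocalActionDiagram.{u}) (V : Type u) (T : SimpleGraph V) (S : DeltaTree Δ T),
        HasPropertyP T S.universalGroup,
      -- The bijection between isomorphism classes of local action diagrams and conjugacy classes
      -- of `P`-closed actions; it takes the class of `Δ` to the class of `(T, U(Δ))`, for any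
      -- `Δ`-tree `T`, and its inverse takes the class of `(T, G)` to the class of any local
      -- action diagram associated to `(T, G)`.
      ∃ e : Quotient LocalActionDiagram.isoSetoid.{u} ≃ Quotient PClosedAction.conjSetoid.{u},
        (∀ (Δ : LocalActionDiagram.{u}) (V : Type u) (T : SimpleGraph V) (S : DeltaTree Δ T),
          e (Quotient.mk _ Δ) = Quotient.mk _ ⟨V, T, S.isTree, S.universalGroup, hU Δ V T S⟩) ∧
        (∀ (P : PClosedAction.{u}) (κ : AssociatedChoice P.T P.G),
          e.symm (Quotient.mk _ P) = Quotient.mk _ (κ.diagram P.isTree))) ∧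
    -- For an arbitrary group `G` of automorphisms of a tree `T`, the universal group of the
    -- associated local action diagram, acting on `T`, is the `P`-closure of `G`.
    (∀ (V : Type u) (T : SimpleGraph V) (hT : T.IsTree) (G : Subgroup (T ≃g T))
        (κ : AssociatedChoice T G),
      (κ.deltaTree hT).universalGroup = pkClosure T hT 1 G ∧
      IsLeast {H : Subgroup (T ≃g T) | G ≤ H ∧ HasPropertyP T H}
        (κ.deltaTree hT).universalGroup) := by
  refine ⟨LocalActionDiagram.exists_deltaTree, ⟨fun _ _ _ S => S.hasPropertyP_universalGroup, ?_⟩,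
    fun V T hT G κ => ⟨κ.universalGroup_eq_pkClosure hT,
      ⟨κ.le_universalGroup hT, (κ.deltaTree hT).hasPropertyP_universalGroup⟩, ?_⟩⟩
  · choose V T S using LocalActionDiagram.exists_deltaTree.{u}
    let S := fun Δ => (S Δ).some
    let act {Δ : LocalActionDiagram.{u}} {V : Type u} {T : SimpleGraph V} (S : DeltaTree Δ T) :
        PClosedAction.{u} := ⟨V, T, S.isTree, S.universalGroup, S.hasPropertyP_universalGroup⟩
    let f : Quotient LocalActionDiagram.isoSetoid.{u} → Quotient PClosedAction.conjSetoid.{u} :=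
      Quotient.map (fun Δ => act (S Δ)) fun Δ Δ' ⟨e⟩ => exists_conj_of_iso e (S Δ) (S Δ')
    have hf (Δ : LocalActionDiagram.{u}) {V : Type u} {T : SimpleGraph V} (S' : DeltaTree Δ T) :
        f (Quotient.mk _ Δ) = Quotient.mk _ (act S') := by
      obtain ⟨e⟩ : Nonempty (LocalActionDiagram.Iso Δ Δ) := Setoid.refl Δ
      exact Quotient.sound (exists_conj_of_iso e (S Δ) S')
    have hf' (P : PClosedAction.{u}) (κ : AssociatedChoice P.T P.G) :
        f (Quotient.mk _ (κ.diagram P.isTree)) = Quotient.mk _ P := by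
      rw [hf _ (κ.deltaTree P.isTree)]
      congr 1
      obtain ⟨V, T, hT, G, hG⟩ := P
      simp only [act, κ.universalGroup_eq_self hT hG]
    have hbij : Function.Bijective f := by
      constructor
      · refine Quotient.ind₂ fun Δ Δ' h => ?_
        obtain ⟨θ, hθ⟩ := Quotient.exact h
        exact Quotient.sound (equiv_of_conj (S Δ) (S Δ') θ hθ)
      · refine Quotient.ind fun P => ?_
        obtain ⟨κ⟩ : Nonempty (AssociatedChoice P.T P.G) := inferInstance
        exact ⟨_, hf' P κ⟩
    refine ⟨Equiv.ofBijective f hbij, fun Δ V T S' => hf Δ S', fun P κ => ?_⟩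
    rw [Equiv.symm_apply_eq]
    exact (hf' P κ).symm
  · rintro H ⟨hGH, hH⟩
    rw [κ.universalGroup_eq_pkClosure hT]
    exact (pkClosure_mono hT 1 hGH).trans (hH.pkClosure_le hT)
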